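/- All manifolds are finite-dimensional, real, smooth and without boundary, and vector bundles are smooth, real and of finite rank. A double vector bundle $(D;A,B;M)$ consists of vector bundles $q_A\colon A\to M$ and $q_B\colon B\to M$ and of two vector bundle structures $q^D_A\colon D\to A$ and $q^D_B\colon D\to B$ on $D$, such that the projection, zero section, addition and scalar multiplication of each structure on $D$ are morphisms of vector bundles with respect to the other structures, and $(q^D_A,q^D_B)\colon D\to A\times_M B$ is a surjective submersion. Write $+_A,-_A,\tilde 0^A$ and $+_B,-_B,\tilde 0^B$ for the operations and zero sections of $D\to A$ and $D\to B$. The core $C\subseteq D$ is the set of elements which project to zero elements under both $q^D_A$ and $q^D_B$; it is an embedded submanifold of $D$ and a vector bundle over $M$. A linear section $(\xi,X)$ of $D\to B$ consists of smooth sections $X$ of $A\to M$ and $\xi\colon B\to D$ of $q^D_B$ such that $\xi$ is a morphism of vector bundles from $B\to M$ to $D\to A$ over $X$; a linear section $(\eta,Y)$ of $D\to A$, with $Y\colon M\to B$ and $\eta\colon A\to D$, is defined in the same way with $A$ and $B$ interchanged. A grid on $D$ is a pair $(\xi,X)$, $(\eta,Y)$ of such linear sections. Its warp is the section $\operatorname{warp}(\xi,\eta)$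 of $C\to M$ determined by $$\xi(Y(m))-_A\eta(X(m))=\operatorname{warp}(\xi,\eta)(m)+_B\tilde 0^A_{X(m)},\qquad \xi(Y(m))-_B\eta(X(m))=\operatorname{warp}(\xi,\eta)(m)+_A\tilde 0^B_{Y(m)}\qquad(m\in M).$$ **Proposition.** Let $(\xi,X)$, $(\eta,Y)$ be a grid on a double vector bundle $(D;A,B;M)$ with core $C$. Apply the tangent functor to all the structure maps of $D$ (the addition of, say, $TD\to TA$ is the tangent map of $+_A\colon D\times_A D\to D$, with $T(D\times_A D)=TD\times_{TA}TD$). Then $(TD;TA,TB;TM)$ is a double vector bundle with core $TC\subseteq TD$, and $(T(\xi),T(X))$, $(T(\eta),T(Y))$ is a grid on it. Both grids have a unique warp, and the warp of the tangent grid is the tangent of the warp of the original grid: $$\operatorname{warp}(T(\xi),T(\eta))=T(\operatorname{warp}(\xi,\eta))\in\Gamma_{TM}(TC).$$ -/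

import Mathlib

open Set Filter
open scoped Manifold ContDiff Topology

noncomputable section

/-- The four structure maps of a vector bundle with total space `A` and base `M`:
the projection, the zero section, fibrewise addition and fibrewise scalar multiplication.
The value `add a b` is only meaningful if `a` and `b` lie in the same fibre. -/
structure VBData (A M : Type*) where
  proj : A → M
  zero : M → A
  add : A → A → A
  smul : ℝ → A → A

/-- The four vector bundle structures (as raw data) of a square with total space `D`,
side bundles `A` and `B`, and base `M`. -/
structure DVBData (D A B M : Type*) where
  /-- the structure of `D` over `A` -/
  overA : VBData D A
  /-- the structure of `D` over `B` -/
  overB : VBData D B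
  /-- the structure of `A` over `M` -/
  sideA : VBData A M
  /-- the structure of `B` over `M` -/
  sideB : VBData B M

namespace VBData

/-- Fibrewise subtraction. -/
def sub {A M : Type*} (S : VBData A M) (a b : A) : A := S.add a (S.smul (-1) b)

/-- `F : A → A'` is fibrewise linear over `f : M → M'`. -/
structure IsLinearOver {A M A' M' : Type*} (S : VBData A M) (S' : VBData A' M')
    (F : A → A') (f : M → M') : Prop where
  proj : ∀ a, S'.proj (F a) = f (S.proj a)
  add : ∀ a b, S.proj a = S.proj b → F (S.add a b) = S'.add (F a) (F b)
  smul : ∀ (t : ℝ) (a : A), F (S.smul t a) = S'.smul t (F a)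

/-- The operations make `A` a smooth real vector bundle of finite rank over `M`: they preserve the
fibres, and around each point of `M` there is a smooth local trivialization which is linear on
each fibre. (Since a trivialization is bijective on fibres, this makes every fibre a
vector space, and it makes all the structure maps smooth.) -/
structure IsVectorBundle {EA HA A EM HM M : Type*}
    [NormedAddCommGroup EA] [NormedSpace ℝ EA] [TopologicalSpace HA]
    [NormedAddCommGroup EM] [NormedSpace ℝ EM] [TopologicalSpace HM]
    [TopologicalSpace A] [ChartedSpace HA A] [TopologicalSpace M] [ChartedSpace HM M]
    (IA : ModelWithCorners ℝ EA HA) (IM : ModelWithCorners ℝ EM HM)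
    (S : VBData A M) : Prop where
  proj_zero : ∀ m, S.proj (S.zero m) = m
  proj_add : ∀ a b, S.proj a = S.proj b → S.proj (S.add a b) = S.proj a
  proj_smul : ∀ (t : ℝ) (a : A), S.proj (S.smul t a) = S.proj a
  exists_trivialization : ∀ m : M,
    ∃ (n : ℕ) (φ : Bundle.Trivialization (EuclideanSpace ℝ (Fin n)) S.proj),
      m ∈ φ.baseSet ∧
      ContMDiffOn IA (IM.prod 𝓘(ℝ, EuclideanSpace ℝ (Fin n))) ∞ φ φ.source ∧
      ContMDiffOn (IM.prod 𝓘(ℝ, EuclideanSpace ℝ (Fin n))) IA ∞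
        φ.toOpenPartialHomeomorph.symm φ.target ∧
      (∀ x ∈ φ.baseSet, (φ (S.zero x)).2 = 0) ∧
      (∀ a b, S.proj a ∈ φ.baseSet → S.proj a = S.proj b →
        (φ (S.add a b)).2 = (φ a).2 + (φ b).2) ∧
      (∀ (t : ℝ) (a : A), S.proj a ∈ φ.baseSet → (φ (S.smul t a)).2 = t • (φ a).2)

/-- The tangent prolongation `TA → TM` of `A → M`: the tangent functor is applied to each
structure map. The addition of `A` is a map `A ×_M A → A`, so the addition of `TA` is its
derivative on `T(A ×_M A) = TA ×_{TM} TA`. It is written as the derivative, within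
`A ×_M A ⊆ A × A`, of the addition at `(a, b)`, applied to the pair `(v, w)`;
a derivative within a subset is determined on the vectors tangent to the subset, in particular
on all pairs with `T(q)(v) = T(q)(w)`. Thus, for smooth curves `a_t`, `b_t` with
`q(a_t) = q(b_t)`, the velocity of `a_t + b_t` is the sum in `TA → TM` of the velocities. -/
def tangent {EA HA A EM HM M : Type*}
    [NormedAddCommGroup EA] [NormedSpace ℝ EA] [TopologicalSpace HA]
    [NormedAddCommGroup EM] [NormedSpace ℝ EM] [TopologicalSpace HM]
    [TopologicalSpace A] [ChartedSpace HA A] [TopologicalSpace M] [ChartedSpace HM M]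
    (IA : ModelWithCorners ℝ EA HA) (IM : ModelWithCorners ℝ EM HM)
    (S : VBData A M) : VBData (TangentBundle IA A) (TangentBundle IM M) where
  proj := tangentMap IA IM S.proj
  zero := tangentMap IM IA S.zero
  add v w :=
    ⟨S.add v.proj w.proj,
      mfderivWithin (IA.prod IA) IA (fun p : A × A => S.add p.1 p.2)
        {p : A × A | S.proj p.1 = S.proj p.2} (v.proj, w.proj) (v.snd, w.snd)⟩
  smul t := tangentMap IA IA (S.smul t)

end VBData

/-- The set of vectors tangent to a subset `C` of a manifold: the velocities at `0` of smooth
curves lying in `C`. For an embedded submanifold `C` this is `TC`, as a subset of `TD`. -/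
def tangentSet {ED HD D : Type*}
    [NormedAddCommGroup ED] [NormedSpace ℝ ED] [TopologicalSpace HD]
    [TopologicalSpace D] [ChartedSpace HD D]
    (ID : ModelWithCorners ℝ ED HD) (C : Set D) : Set (TangentBundle ID D) :=
  {v | ∃ (γ : ℝ → D) (J : Set ℝ), J ∈ 𝓝 (0 : ℝ) ∧ ContMDiffOn 𝓘(ℝ, ℝ) ID ∞ γ J ∧
    (∀ t ∈ J, γ t ∈ C) ∧
    tangentMap 𝓘(ℝ, ℝ) ID γ (⟨0, (1 : ℝ)⟩ : TangentBundle 𝓘(ℝ, ℝ) ℝ) = v}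

namespace DVBData

/-- Interchange the roles of the two side bundles. -/
def swap {D A B M : Type*} (Q : DVBData D A B M) : DVBData D B A M where
  overA := Q.overB
  overB := Q.overA
  sideA := Q.sideB
  sideB := Q.sideA

/-- The core: the elements projecting to zeros under both bundle projections. -/
def core {D A B M : Type*} (Q : DVBData D A B M) : Set D :=
  {d | ∃ m : M, Q.overA.proj d = Q.sideA.zero m ∧ Q.overB.proj d = Q.sideB.zero m}

section

variable {ED HD D EA HA A EB HB B EM HM M : Type*}
  [NormedAddCommGroup ED] [NormedSpace ℝ ED] [TopologicalSpace HD]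
  [NormedAddCommGroup EA] [NormedSpace ℝ EA] [TopologicalSpace HA]
  [NormedAddCommGroup EB] [NormedSpace ℝ EB] [TopologicalSpace HB]
  [NormedAddCommGroup EM] [NormedSpace ℝ EM] [TopologicalSpace HM]
  [TopologicalSpace D] [ChartedSpace HD D] [TopologicalSpace A] [ChartedSpace HA A]
  [TopologicalSpace B] [ChartedSpace HB B] [TopologicalSpace M] [ChartedSpace HM M]
  (ID : ModelWithCorners ℝ ED HD) (IA : ModelWithCorners ℝ EA HA)
  (IB : ModelWithCorners ℝ EB HB) (IM : ModelWithCorners ℝ EM HM)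

/-- A double vector bundle: four smooth vector bundles such that each structure map of either
structure on `D` is a morphism with respect to the other structure, and such that
`D → A ×_M B` is a surjective submersion. -/
structure IsDoubleVectorBundle (Q : DVBData D A B M) : Prop where
  vb_overA : Q.overA.IsVectorBundle ID IA
  vb_overB : Q.overB.IsVectorBundle ID IB
  vb_sideA : Q.sideA.IsVectorBundle IA IM
  vb_sideB : Q.sideB.IsVectorBundle IB IM
  /-- `q^D_B : D → B` is a morphism over `q_A : A → M`, and symmetrically. -/
  proj_overB : Q.overA.IsLinearOver Q.sideB Q.overB.proj Q.sideA.proj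
  proj_overA : Q.overB.IsLinearOver Q.sideA Q.overA.proj Q.sideB.proj
  /-- The zero section `A → D` is a morphism over the zero section `M → B`,
  and symmetrically. -/
  zero_overA : Q.sideA.IsLinearOver Q.overB Q.overA.zero Q.sideB.zero
  zero_overB : Q.sideB.IsLinearOver Q.overA Q.overB.zero Q.sideA.zero
  /-- Scalar multiplication in `D → A` is a morphism over scalar multiplication in `B → M`,
  and symmetrically. -/
  smul_overA : ∀ t : ℝ, Q.overB.IsLinearOver Q.overB (Q.overA.smul t) (Q.sideB.smul t)
  smul_overB : ∀ t : ℝ, Q.overA.IsLinearOver Q.overA (Q.overB.smul t) (Q.sideA.smul t)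
  /-- The two additions satisfy the interchange law. -/
  interchange : ∀ d₁ d₂ d₃ d₄ : D,
    Q.overA.proj d₁ = Q.overA.proj d₂ → Q.overA.proj d₃ = Q.overA.proj d₄ →
    Q.overB.proj d₁ = Q.overB.proj d₃ → Q.overB.proj d₂ = Q.overB.proj d₄ →
    Q.overB.add (Q.overA.add d₁ d₂) (Q.overA.add d₃ d₄) =
      Q.overA.add (Q.overB.add d₁ d₃) (Q.overB.add d₂ d₄)
  /-- `D → A ×_M B` is surjective. -/
  surjective : ∀ (a : A) (b : B), Q.sideA.proj a = Q.sideB.proj b →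
    ∃ d : D, Q.overA.proj d = a ∧ Q.overB.proj d = b
  /-- `D → A ×_M B` is a submersion: every vector of `T(A ×_M B) = TA ×_{TM} TB` at the image
  of `d` is the image of a vector tangent to `D` at `d`. -/
  submersion : ∀ (d : D) (v : TangentBundle IA A) (w : TangentBundle IB B),
    v.proj = Q.overA.proj d → w.proj = Q.overB.proj d →
    tangentMap IA IM Q.sideA.proj v = tangentMap IB IM Q.sideB.proj w →
    ∃ z : TangentBundle ID D, z.proj = d ∧
      tangentMap ID IA Q.overA.proj z = v ∧ tangentMap ID IB Q.overB.proj z = w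

/-- `(ξ, X)` is a linear section: `X` is a smooth section of `A → M`, `ξ` is a smooth section of
`D → B`, and `ξ` is a morphism of vector bundles from `B → M` to `D → A` over `X`. -/
structure IsLinearSection (Q : DVBData D A B M) (ξ : B → D) (X : M → A) : Prop where
  smooth_base : ContMDiff IM IA ∞ X
  section_base : ∀ m, Q.sideA.proj (X m) = m
  smooth : ContMDiff IB ID ∞ ξ
  section_overB : ∀ b, Q.overB.proj (ξ b) = b
  linear : Q.sideB.IsLinearOver Q.overA ξ X

/-- A grid: a linear section `(ξ, X)` with `ξ : B → D`, `X : M → A`, and a linear section `(η, Y)`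
with `η : A → D`, `Y : M → B`. -/
structure IsGrid (Q : DVBData D A B M) (ξ : B → D) (X : M → A) (η : A → D) (Y : M → B) :
    Prop where
  linear_ξ : IsLinearSection ID IA IB IM Q ξ X
  linear_η : IsLinearSection ID IB IA IM Q.swap η Y

/-- `w` is the warp of the grid: a smooth section of the core such that
`ξ(Y(m)) -_A η(X(m)) = w(m) +_B 0_{X(m)}` and `ξ(Y(m)) -_B η(X(m)) = w(m) +_A 0_{Y(m)}`. -/
structure IsWarp (Q : DVBData D A B M) (ξ : B → D) (X : M → A) (η : A → D) (Y : M → B)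
    (w : M → D) : Prop where
  smooth : ContMDiff IM ID ∞ w
  overA_eq_zero : ∀ m, Q.overA.proj (w m) = Q.sideA.zero m
  overB_eq_zero : ∀ m, Q.overB.proj (w m) = Q.sideB.zero m
  sub_overA : ∀ m, Q.overA.sub (ξ (Y m)) (η (X m)) = Q.overB.add (w m) (Q.overA.zero (X m))
  sub_overB : ∀ m, Q.overB.sub (ξ (Y m)) (η (X m)) = Q.overA.add (w m) (Q.overB.zero (Y m))

/-- The tangent square `TD`, with sides `TA`, `TB` and base `TM`. -/
def tangent (Q : DVBData D A B M) :
    DVBData (TangentBundle ID D) (TangentBundle IA A) (TangentBundle IB B) (TangentBundle IM M)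
    where
  overA := Q.overA.tangent ID IA
  overB := Q.overB.tangent ID IB
  sideA := Q.sideA.tangent IA IM
  sideB := Q.sideB.tangent IB IM

end

end DVBData

end

/-!
The tangent functor is read off curves. Every tangent vector is the velocity `velocity I γ` of a
smooth curve `γ` through its base point, and the structure maps of the tangent prolongation of a
vector bundle act on velocities by acting on curves; for the addition this is
`VBData.IsVectorBundle.velocity_add`, an instance of the chain rule, which pins down the derivative
within `A ×_M A` on the pairs of vectors tangent to it. So an identity between operations in `D`
gives the same identity in `TD` as soon as the tangent vectors involved can be realized by curves
which satisfy, at every parameter, the compatibility conditions that the vectors satisfy.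

Such curves come from two lifting results. In a single vector bundle, a tangent vector over the
velocity of a curve in the base is the velocity of a curve over that curve
(`VBData.IsVectorBundle.exists_isSmoothCurve_lift`; this is read in a trivialization). In a double
vector bundle, a curve in `A ×_M B` lifts to `D` with a prescribed compatible velocity
(`DVBData.IsDoubleVectorBundle.exists_isSmoothCurve_lift`). The latter rests on the fact that
`D → B` is a morphism of vector bundles over `A → M` which is surjective on fibres. In
trivializations, along a curve in `A`, it is a smooth family of surjective linear maps, and such a
family has a smooth family of right inverses (`exists_isSmoothCurve_solution`,
`VBData.IsLinearOver.exists_isSmoothCurve_lift`). No inverse function theorem is needed.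

The consequences are the following. The tangent prolongation of a vector bundle is a vector bundle,
trivialized by the derivatives of linear trivializations (`VBData.IsVectorBundle.tangent`), and the
tangent map of a linear map is linear (`VBData.IsLinearOver.tangent`). The interchange law of `TD`
follows by lifting four vectors to four compatible curves. The core of `TD` consists of the
velocities of curves in the core `C`, since a vector in it can be realized by a lift of a curve of
pairs of zeros. Finally `T(w)` satisfies the equations of a warp because `w` does, and a warp is
unique, in `D` as well as in `TD`, by cancellation in the fibres of the bundle over `B`.
-/

/-! ### Curves and their velocities -/

section Curves

variable {E H M E' H' M' : Type*}
  [NormedAddCommGroup E] [NormedSpace ℝ E] [TopologicalSpace H]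
  [NormedAddCommGroup E'] [NormedSpace ℝ E'] [TopologicalSpace H']
  [TopologicalSpace M] [ChartedSpace H M] [TopologicalSpace M'] [ChartedSpace H' M']
  {I : ModelWithCorners ℝ E H} {I' : ModelWithCorners ℝ E' H'}

/-- `γ` is smooth at all parameters close to `0`. As smoothness of order `∞` at a single parameter
only gives, for each finite order, a neighbourhood depending on that order, the condition is
imposed at all nearby parameters. -/
def IsSmoothCurve (I : ModelWithCorners ℝ E H) (γ : ℝ → M) : Prop :=
  ∀ᶠ t in 𝓝 (0 : ℝ), ContMDiffAt 𝓘(ℝ, ℝ) I ∞ γ t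

/-- The velocity of the curve `γ` at the parameter `0`, as an element of the tangent bundle. -/
noncomputable def velocity (I : ModelWithCorners ℝ E H) (γ : ℝ → M) : TangentBundle I M :=
  tangentMap 𝓘(ℝ, ℝ) I γ (⟨0, (1 : ℝ)⟩ : TangentBundle 𝓘(ℝ, ℝ) ℝ)

theorem ContMDiffOn.eventually_contMDiffAt {f : M → M'} {U : Set M} {x : M}
    (hf : ContMDiffOn I I' ∞ f U) (hU : IsOpen U) (hx : x ∈ U) :
    ∀ᶠ y in 𝓝 x, ContMDiffAt I I' ∞ f y :=
  (hU.eventually_mem hx).mono fun _ hy => hf.contMDiffAt (hU.mem_nhds hy)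

namespace IsSmoothCurve

variable {γ : ℝ → M}

theorem contMDiffAt (hγ : IsSmoothCurve I γ) : ContMDiffAt 𝓘(ℝ, ℝ) I ∞ γ 0 := hγ.self_of_nhds

theorem continuousAt (hγ : IsSmoothCurve I γ) : ContinuousAt γ 0 := hγ.contMDiffAt.continuousAt

theorem mdifferentiableAt (hγ : IsSmoothCurve I γ) : MDifferentiableAt 𝓘(ℝ, ℝ) I γ 0 :=
  hγ.contMDiffAt.mdifferentiableAt (by simp)

theorem comp (hγ : IsSmoothCurve I γ) {f : M → M'}
    (hf : ∀ᶠ x in 𝓝 (γ 0), ContMDiffAt I I' ∞ f x) : IsSmoothCurve I' fun t => f (γ t) := by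
  filter_upwards [hγ, hγ.continuousAt.eventually hf] with t h1 h2
  exact h2.comp t h1

theorem comp_contMDiff (hγ : IsSmoothCurve I γ) {f : M → M'} (hf : ContMDiff I I' ∞ f) :
    IsSmoothCurve I' fun t => f (γ t) :=
  hγ.comp (.of_forall fun x => hf x)

theorem prodMk (hγ : IsSmoothCurve I γ) {δ : ℝ → M'} (hδ : IsSmoothCurve I' δ) :
    IsSmoothCurve (I.prod I') fun t => (γ t, δ t) := by
  filter_upwards [hγ, hδ] with t h1 h2 using h1.prodMk h2

theorem const (x : M) : IsSmoothCurve I fun _ => x := .of_forall fun _ => contMDiffAt_const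

theorem of_contDiff {F : Type*} [NormedAddCommGroup F] [NormedSpace ℝ F] {x : ℝ → F}
    (hx : ContDiff ℝ ∞ x) : IsSmoothCurve 𝓘(ℝ, F) x :=
  .of_forall fun _ => hx.contMDiff.contMDiffAt

end IsSmoothCurve

theorem isSmoothCurve_iff_contDiffAt {F : Type*} [NormedAddCommGroup F] [NormedSpace ℝ F]
    {x : ℝ → F} : IsSmoothCurve 𝓘(ℝ, F) x ↔ ∀ᶠ t in 𝓝 (0 : ℝ), ContDiffAt ℝ ∞ x t := by
  simp only [IsSmoothCurve, contMDiffAt_iff_contDiffAt]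

theorem velocity_comp {γ : ℝ → M} (hγ : IsSmoothCurve I γ) {f : M → M'}
    (hf : MDifferentiableAt I I' f (γ 0)) :
    velocity I' (fun t => f (γ t)) = tangentMap I I' f (velocity I γ) :=
  tangentMap_comp_at (I := 𝓘(ℝ, ℝ)) (g := f) (f := γ)
    (⟨0, (1 : ℝ)⟩ : TangentBundle 𝓘(ℝ, ℝ) ℝ) hf hγ.mdifferentiableAt

theorem velocity_congr {γ δ : ℝ → M} (h : γ =ᶠ[𝓝 0] δ) : velocity I γ = velocity I δ := by
  have h0 : γ 0 = δ 0 := h.self_of_nhds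
  have h1 := h.mfderiv_eq (I := 𝓘(ℝ, ℝ)) (I' := I)
  refine Bundle.TotalSpace.ext h0 ?_
  exact heq_of_eq (congrArg (fun L : ℝ →L[ℝ] E => L 1) h1)

/-- The velocity of a pair of curves is the pair of velocities, under `T(M × M') = TM × TM'`. -/
theorem velocity_prodMk {γ : ℝ → M} {δ : ℝ → M'} (hγ : IsSmoothCurve I γ)
    (hδ : IsSmoothCurve I' δ) :
    velocity (I.prod I') (fun t => (γ t, δ t)) =
      (equivTangentBundleProd I M I' M').symm (velocity I γ, velocity I' δ) := by
  rw [Equiv.eq_symm_apply, equivTangentBundleProd_eq_tangentMap_prod_tangentMap]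
  refine Prod.ext ?_ ?_
  · exact (velocity_comp (hγ.prodMk hδ) mdifferentiableAt_fst).symm
  · exact (velocity_comp (hγ.prodMk hδ) mdifferentiableAt_snd).symm

theorem velocity_vectorSpace {F : Type*} [NormedAddCommGroup F] [NormedSpace ℝ F] (x : ℝ → F) :
    velocity 𝓘(ℝ, F) x = (⟨x 0, deriv x 0⟩ : TangentBundle 𝓘(ℝ, F) F) := by
  refine Bundle.TotalSpace.ext rfl (heq_of_eq ?_)
  change mfderiv 𝓘(ℝ, ℝ) 𝓘(ℝ, F) x 0 (1 : ℝ) = deriv x 0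
  rw [mfderiv_eq_fderiv]
  exact fderiv_apply_one_eq_deriv (𝕜 := ℝ) (f := x) (x := 0)

theorem velocity_vectorSpace_eq {F : Type*} [NormedAddCommGroup F] [NormedSpace ℝ F] {x : ℝ → F}
    {p w : F} (h0 : x 0 = p) (hd : deriv x 0 = w) :
    velocity 𝓘(ℝ, F) x = (⟨p, w⟩ : TangentBundle 𝓘(ℝ, F) F) := by
  subst h0 hd
  exact velocity_vectorSpace x

/-- Every tangent vector is the velocity of a smooth curve: a straight line in a chart, which is
defined near `0` because there is no boundary. -/
theorem exists_isSmoothCurve_velocity [IsManifold I ∞ M] [I.Boundaryless]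
    (v : TangentBundle I M) : ∃ γ : ℝ → M, IsSmoothCurve I γ ∧ velocity I γ = v := by
  obtain ⟨x, w⟩ := v
  change E at w
  let c : ℝ → E := fun t => extChartAt I x x + t • w
  have hc : IsSmoothCurve 𝓘(ℝ, E) c := .of_contDiff (by fun_prop)
  have hc0 : c 0 = extChartAt I x x := by simp [c]
  have hd : deriv c 0 = w := by
    have : HasDerivAt c ((1 : ℝ) • w) 0 :=
      ((hasDerivAt_id (0 : ℝ)).smul_const w).const_add _
    rw [this.deriv, one_smul]
  have hs : ∀ᶠ y in 𝓝 (c 0), ContMDiffAt 𝓘(ℝ, E) I ∞ (extChartAt I x).symm y :=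
    (contMDiffOn_extChartAt_symm x).eventually_contMDiffAt (isOpen_extChartAt_target x)
      (hc0 ▸ mem_extChartAt_target x)
  refine ⟨fun t => (extChartAt I x).symm (c t), hc.comp hs, ?_⟩
  rw [velocity_comp hc (hs.self_of_nhds.mdifferentiableAt (by simp)),
    velocity_vectorSpace_eq hc0 hd]
  refine Bundle.TotalSpace.ext (extChartAt_to_inv x) (heq_of_eq ?_)
  change mfderiv 𝓘(ℝ, E) I (extChartAt I x).symm (extChartAt I x x) w = w
  have h := mfderivWithin_range_extChartAt_symm (I := I) (x := x)
  rw [I.range_eq_univ, mfderivWithin_univ] at h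
  exact congrArg (fun L : E →L[ℝ] E => L w) h

end Curves

/-! ### Linear trivializations -/

namespace VBData

section Trivializations

variable {EA HA A EM HM M F EN HN N : Type*}
  [NormedAddCommGroup EA] [NormedSpace ℝ EA] [TopologicalSpace HA]
  [NormedAddCommGroup EM] [NormedSpace ℝ EM] [TopologicalSpace HM]
  [NormedAddCommGroup EN] [NormedSpace ℝ EN] [TopologicalSpace HN]
  [NormedAddCommGroup F] [NormedSpace ℝ F]
  [TopologicalSpace A] [ChartedSpace HA A] [TopologicalSpace M] [ChartedSpace HM M]
  [TopologicalSpace N] [ChartedSpace HN N]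
  {IA : ModelWithCorners ℝ EA HA} {IM : ModelWithCorners ℝ EM HM}
  {IN : ModelWithCorners ℝ EN HN} {S : VBData A M}

/-- `φ` is a smooth local trivialization of `A → M` which is linear on each fibre. -/
structure IsLinearTrivialization (IA : ModelWithCorners ℝ EA HA) (IM : ModelWithCorners ℝ EM HM)
    (S : VBData A M) (φ : Bundle.Trivialization F S.proj) : Prop where
  contMDiffOn : ContMDiffOn IA (IM.prod 𝓘(ℝ, F)) ∞ φ φ.source
  contMDiffOn_symm : ContMDiffOn (IM.prod 𝓘(ℝ, F)) IA ∞ φ.toOpenPartialHomeomorph.symm φ.target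
  snd_zero : ∀ x ∈ φ.baseSet, (φ (S.zero x)).2 = 0
  snd_add : ∀ a b, S.proj a ∈ φ.baseSet → S.proj a = S.proj b →
    (φ (S.add a b)).2 = (φ a).2 + (φ b).2
  snd_smul : ∀ (t : ℝ) (a : A), S.proj a ∈ φ.baseSet → (φ (S.smul t a)).2 = t • (φ a).2

theorem IsVectorBundle.exists_isLinearTrivialization (hS : S.IsVectorBundle IA IM) (m : M) :
    ∃ (n : ℕ) (φ : Bundle.Trivialization (EuclideanSpace ℝ (Fin n)) S.proj),
      m ∈ φ.baseSet ∧ S.IsLinearTrivialization IA IM φ := by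
  obtain ⟨n, φ, hm, h1, h2, h3, h4, h5⟩ := hS.exists_trivialization m
  exact ⟨n, φ, hm, h1, h2, h3, h4, h5⟩

omit [NormedSpace ℝ F] in
theorem trivialization_ext (φ : Bundle.Trivialization F S.proj) {a b : A}
    (ha : S.proj a ∈ φ.baseSet) (h : S.proj a = S.proj b) (h2 : (φ a).2 = (φ b).2) : a = b := by
  have ha' := φ.mem_source.2 ha
  have hb' := φ.mem_source.2 (h ▸ ha)
  refine φ.injOn ha' hb' (Prod.ext ?_ h2)
  exact (φ.coe_fst ha').trans (h.trans (φ.coe_fst hb').symm)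

namespace IsLinearTrivialization

variable {φ : Bundle.Trivialization F S.proj}

theorem eventually_contMDiffAt_snd (hφ : S.IsLinearTrivialization IA IM φ) {a : A}
    (ha : S.proj a ∈ φ.baseSet) :
    ∀ᶠ b in 𝓝 a, ContMDiffAt IA 𝓘(ℝ, F) ∞ (fun b => (φ b).2) b :=
  ((contMDiff_snd.comp_contMDiffOn hφ.contMDiffOn).eventually_contMDiffAt φ.open_source
    (φ.mem_source.2 ha))

theorem eventually_contMDiffAt_proj (hφ : S.IsLinearTrivialization IA IM φ) {a : A}
    (ha : S.proj a ∈ φ.baseSet) : ∀ᶠ b in 𝓝 a, ContMDiffAt IA IM ∞ S.proj b := by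
  have h : ContMDiffOn IA IM ∞ S.proj φ.source :=
    (contMDiff_fst.comp_contMDiffOn hφ.contMDiffOn).congr fun b hb => (φ.coe_fst hb).symm
  exact h.eventually_contMDiffAt φ.open_source (φ.mem_source.2 ha)

theorem eventually_contMDiffAt_symm (hφ : S.IsLinearTrivialization IA IM φ) {p : M × F}
    (hp : p.1 ∈ φ.baseSet) :
    ∀ᶠ q in 𝓝 p, ContMDiffAt (IM.prod 𝓘(ℝ, F)) IA ∞ φ.toOpenPartialHomeomorph.symm q :=
  hφ.contMDiffOn_symm.eventually_contMDiffAt φ.open_target (φ.mem_target.2 hp)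

theorem isSmoothCurve_snd (hφ : S.IsLinearTrivialization IA IM φ) {γ : ℝ → A}
    (hγ : IsSmoothCurve IA γ) (h0 : S.proj (γ 0) ∈ φ.baseSet) :
    IsSmoothCurve 𝓘(ℝ, F) fun t => (φ (γ t)).2 :=
  hγ.comp (hφ.eventually_contMDiffAt_snd h0)

theorem isSmoothCurve_symm (hφ : S.IsLinearTrivialization IA IM φ) {m : ℝ → M} {x : ℝ → F}
    (hm : IsSmoothCurve IM m) (hx : IsSmoothCurve 𝓘(ℝ, F) x) (h0 : m 0 ∈ φ.baseSet) :
    IsSmoothCurve IA fun t => φ.toOpenPartialHomeomorph.symm (m t, x t) :=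
  (hm.prodMk hx).comp (hφ.eventually_contMDiffAt_symm h0)

/-- A tangent vector is recovered from its base component and its fibre component. -/
theorem tangentMap_symm_velocity (hφ : S.IsLinearTrivialization IA IM φ) {γ : ℝ → A}
    (hγ : IsSmoothCurve IA γ) (h0 : S.proj (γ 0) ∈ φ.baseSet) :
    tangentMap (IM.prod 𝓘(ℝ, F)) IA φ.toOpenPartialHomeomorph.symm
      ((equivTangentBundleProd IM M 𝓘(ℝ, F) F).symm
        (velocity IM (fun t => S.proj (γ t)), velocity 𝓘(ℝ, F) (fun t => (φ (γ t)).2))) =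
      velocity IA γ := by
  have hp : IsSmoothCurve IM fun t => S.proj (γ t) :=
    hγ.comp (hφ.eventually_contMDiffAt_proj h0)
  have hs := hφ.isSmoothCurve_snd hγ h0
  rw [← velocity_prodMk hp hs, ← velocity_comp (hp.prodMk hs)
    ((hφ.eventually_contMDiffAt_symm h0).self_of_nhds.mdifferentiableAt (by simp))]
  refine velocity_congr ?_
  filter_upwards [hγ.continuousAt.eventually
    (φ.open_source.eventually_mem (φ.mem_source.2 h0))] with t ht
  exact φ.symm_apply_mk_proj ht

/-- Two curves in the total space have the same velocity as soon as their base components and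
their fibre components have. -/
theorem velocity_ext (hφ : S.IsLinearTrivialization IA IM φ) {γ δ : ℝ → A}
    (hγ : IsSmoothCurve IA γ) (hδ : IsSmoothCurve IA δ) (h0 : S.proj (γ 0) ∈ φ.baseSet)
    (h1 : velocity IM (fun t => S.proj (γ t)) = velocity IM (fun t => S.proj (δ t)))
    (h2 : velocity 𝓘(ℝ, F) (fun t => (φ (γ t)).2) = velocity 𝓘(ℝ, F) (fun t => (φ (δ t)).2)) :
    velocity IA γ = velocity IA δ := by
  have h01 : S.proj (γ 0) = S.proj (δ 0) := congrArg Bundle.TotalSpace.proj h1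
  rw [← hφ.tangentMap_symm_velocity hγ h0, ← hφ.tangentMap_symm_velocity hδ (h01 ▸ h0), h1, h2]

end IsLinearTrivialization

namespace IsVectorBundle

/-! ### Fibrewise algebra -/

theorem proj_sub (hS : S.IsVectorBundle IA IM) {a b : A} (h : S.proj a = S.proj b) :
    S.proj (S.sub a b) = S.proj a :=
  hS.proj_add _ _ (by rw [hS.proj_smul, h])

theorem add_zero (hS : S.IsVectorBundle IA IM) {a : A} {m : M} (h : S.proj a = m) :
    S.add a (S.zero m) = a := by
  obtain ⟨n, φ, hm, hφ⟩ := hS.exists_isLinearTrivialization m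
  have h0 : S.proj a = S.proj (S.zero m) := by rw [hS.proj_zero, h]
  refine (trivialization_ext φ (h ▸ hm) (hS.proj_add _ _ h0).symm ?_).symm
  rw [hφ.snd_add _ _ (h ▸ hm) h0, hφ.snd_zero _ hm, _root_.add_zero]

theorem add_comm (hS : S.IsVectorBundle IA IM) {a b : A} (h : S.proj a = S.proj b) :
    S.add a b = S.add b a := by
  obtain ⟨n, φ, hm, hφ⟩ := hS.exists_isLinearTrivialization (S.proj a)
  have h1 := hS.proj_add _ _ h
  refine trivialization_ext φ (h1 ▸ hm) (by rw [h1, hS.proj_add _ _ h.symm, h]) ?_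
  rw [hφ.snd_add _ _ hm h, hφ.snd_add _ _ (h ▸ hm) h.symm, _root_.add_comm]

theorem zero_add (hS : S.IsVectorBundle IA IM) {a : A} {m : M} (h : S.proj a = m) :
    S.add (S.zero m) a = a := by
  rw [hS.add_comm (by rw [hS.proj_zero, h]), hS.add_zero h]

theorem sub_self (hS : S.IsVectorBundle IA IM) (a : A) : S.sub a a = S.zero (S.proj a) := by
  obtain ⟨n, φ, hm, hφ⟩ := hS.exists_isLinearTrivialization (S.proj a)
  have h1 : S.proj a = S.proj (S.smul (-1) a) := (hS.proj_smul _ _).symm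
  refine trivialization_ext φ (by rwa [hS.proj_sub rfl])
    (by rw [hS.proj_sub rfl, hS.proj_zero]) ?_
  rw [sub, hφ.snd_add _ _ hm h1, hφ.snd_smul _ _ hm, hφ.snd_zero _ hm, neg_one_smul,
    add_neg_cancel]

theorem add_sub_cancel_right (hS : S.IsVectorBundle IA IM) {a b : A} (h : S.proj a = S.proj b) :
    S.sub (S.add a b) b = a := by
  obtain ⟨n, φ, hm, hφ⟩ := hS.exists_isLinearTrivialization (S.proj a)
  have h1 := hS.proj_add _ _ h
  have h2 : S.proj (S.add a b) = S.proj (S.smul (-1) b) := by rw [hS.proj_smul, h1, h]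
  have h3 : S.proj (S.sub (S.add a b) b) = S.proj a := by rw [hS.proj_sub (h1.trans h), h1]
  refine trivialization_ext φ (h3 ▸ hm) h3 ?_
  rw [sub, hφ.snd_add _ _ (h1 ▸ hm) h2, hφ.snd_add _ _ hm h, hφ.snd_smul _ _ (h ▸ hm),
    neg_one_smul, _root_.add_neg_cancel_right]

theorem sub_add_cancel (hS : S.IsVectorBundle IA IM) {a b : A} (h : S.proj a = S.proj b) :
    S.add (S.sub a b) b = a := by
  obtain ⟨n, φ, hm, hφ⟩ := hS.exists_isLinearTrivialization (S.proj a)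
  have h1 := hS.proj_sub h
  have h2 : S.proj a = S.proj (S.smul (-1) b) := by rw [hS.proj_smul, h]
  have h3 : S.proj (S.add (S.sub a b) b) = S.proj a := by rw [hS.proj_add _ _ (h1.trans h), h1]
  refine trivialization_ext φ (h3 ▸ hm) h3 ?_
  rw [hφ.snd_add _ _ (h1 ▸ hm) (h1.trans h), sub, hφ.snd_add _ _ hm h2,
    hφ.snd_smul _ _ (h ▸ hm), neg_one_smul, neg_add_cancel_right]

theorem add_right_cancel (hS : S.IsVectorBundle IA IM) {a b c : A} (ha : S.proj a = S.proj c)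
    (hb : S.proj b = S.proj c) (h : S.add a c = S.add b c) : a = b := by
  rw [← hS.add_sub_cancel_right ha, h, hS.add_sub_cancel_right hb]

/-! ### Smoothness of the structure maps -/

theorem contMDiff_proj (hS : S.IsVectorBundle IA IM) : ContMDiff IA IM ∞ S.proj := by
  intro a
  obtain ⟨n, φ, hm, hφ⟩ := hS.exists_isLinearTrivialization (S.proj a)
  exact (hφ.eventually_contMDiffAt_proj hm).self_of_nhds

theorem contMDiff_zero (hS : S.IsVectorBundle IA IM) : ContMDiff IM IA ∞ S.zero := by
  intro m
  obtain ⟨n, φ, hm, hφ⟩ := hS.exists_isLinearTrivialization m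
  have h1 : ContMDiffAt IM IA ∞
      (fun x => φ.toOpenPartialHomeomorph.symm (x, (0 : EuclideanSpace ℝ (Fin n)))) m :=
    (hφ.eventually_contMDiffAt_symm (p := (m, 0)) hm).self_of_nhds.comp m
      (contMDiffAt_id.prodMk contMDiffAt_const)
  refine h1.congr_of_eventuallyEq ?_
  filter_upwards [φ.open_baseSet.eventually_mem hm] with x hx
  refine trivialization_ext φ (by rwa [hS.proj_zero]) ?_ ?_
  · rw [hS.proj_zero, φ.proj_symm_apply' hx]
  · rw [hφ.snd_zero _ hx, φ.apply_symm_apply' hx]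

theorem contMDiff_smul (hS : S.IsVectorBundle IA IM) (t : ℝ) :
    ContMDiff IA IA ∞ (S.smul t) := by
  intro a
  obtain ⟨n, φ, hm, hφ⟩ := hS.exists_isLinearTrivialization (S.proj a)
  have h2 : ContMDiffAt IA 𝓘(ℝ, EuclideanSpace ℝ (Fin n)) ∞ (fun b => t • (φ b).2) a :=
    (contDiff_const_smul t).contMDiff.contMDiffAt.comp a
      (hφ.eventually_contMDiffAt_snd hm).self_of_nhds
  have h1 : ContMDiffAt IA IA ∞
      (fun b => φ.toOpenPartialHomeomorph.symm (S.proj b, t • (φ b).2)) a :=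
    (hφ.eventually_contMDiffAt_symm (p := (S.proj a, t • (φ a).2)) hm).self_of_nhds.comp a
      (hS.contMDiff_proj.contMDiffAt.prodMk h2)
  refine h1.congr_of_eventuallyEq ?_
  filter_upwards [φ.open_source.eventually_mem (φ.mem_source.2 hm)] with b hb
  have hb' := φ.mem_source.1 hb
  refine trivialization_ext φ (by rwa [hS.proj_smul]) ?_ ?_
  · rw [hS.proj_smul, φ.proj_symm_apply' hb']
  · rw [hφ.snd_smul _ _ hb', φ.apply_symm_apply' hb']

/-- The addition, which is only meaningful on `A ×_M A`, extends locally to a smooth map on an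
open subset of `A × A`. -/
theorem exists_contMDiffAt_extension_add (hS : S.IsVectorBundle IA IM) {a b : A}
    (h : S.proj a = S.proj b) :
    ∃ f : A × A → A, (∀ᶠ p in 𝓝 (a, b), ContMDiffAt (IA.prod IA) IA ∞ f p) ∧
      ∀ᶠ p in 𝓝 (a, b), S.proj p.1 = S.proj p.2 → S.add p.1 p.2 = f p := by
  obtain ⟨n, φ, hm, hφ⟩ := hS.exists_isLinearTrivialization (S.proj a)
  let f : A × A → A := fun p =>
    φ.toOpenPartialHomeomorph.symm (S.proj p.1, (φ p.1).2 + (φ p.2).2)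
  have hev : ∀ᶠ p : A × A in 𝓝 (a, b), p ∈ φ.source ×ˢ φ.source :=
    (φ.open_source.prod φ.open_source).eventually_mem
      ⟨φ.mem_source.2 hm, φ.mem_source.2 (h ▸ hm)⟩
  refine ⟨f, ?_, ?_⟩
  · filter_upwards [hev] with p hp
    have hp1 := φ.mem_source.1 hp.1
    have hfst : ContMDiffAt (IA.prod IA) IA ∞ Prod.fst p := contMDiffAt_fst
    have hsnd : ContMDiffAt (IA.prod IA) IA ∞ Prod.snd p := contMDiffAt_snd
    have h1 := (hφ.eventually_contMDiffAt_snd hp1).self_of_nhds.comp p hfst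
    have h2 := (hφ.eventually_contMDiffAt_snd (φ.mem_source.1 hp.2)).self_of_nhds.comp p hsnd
    have h3 := hS.contMDiff_proj.contMDiffAt.comp p hfst
    exact (hφ.eventually_contMDiffAt_symm (p := (S.proj p.1, (φ p.1).2 + (φ p.2).2))
      hp1).self_of_nhds.comp p (h3.prodMk (h1.add h2))
  · filter_upwards [hev] with p hp hpq
    have hp1 := φ.mem_source.1 hp.1
    refine trivialization_ext φ (by rwa [hS.proj_add _ _ hpq]) ?_ ?_
    · rw [hS.proj_add _ _ hpq, φ.proj_symm_apply' hp1]
    · rw [hφ.snd_add _ _ hp1 hpq, φ.apply_symm_apply' hp1]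

theorem contMDiffAt_add (hS : S.IsVectorBundle IA IM) {f g : N → A} {x : N}
    (hf : ContMDiffAt IN IA ∞ f x) (hg : ContMDiffAt IN IA ∞ g x)
    (h : ∀ᶠ y in 𝓝 x, S.proj (f y) = S.proj (g y)) :
    ContMDiffAt IN IA ∞ (fun y => S.add (f y) (g y)) x := by
  obtain ⟨F, hF, hadd⟩ := hS.exists_contMDiffAt_extension_add h.self_of_nhds
  have hfg : ContMDiffAt IN (IA.prod IA) ∞ (fun y => (f y, g y)) x := hf.prodMk hg
  refine (ContMDiffAt.comp (g := F) x hF.self_of_nhds hfg).congr_of_eventuallyEq ?_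
  filter_upwards [h, hfg.continuousAt.eventually hadd] with y h1 h2 using h2 h1

theorem contMDiff_sub (hS : S.IsVectorBundle IA IM) {f g : N → A}
    (hf : ContMDiff IN IA ∞ f) (hg : ContMDiff IN IA ∞ g)
    (h : ∀ y, S.proj (f y) = S.proj (g y)) :
    ContMDiff IN IA ∞ (fun y => S.sub (f y) (g y)) := fun x =>
  hS.contMDiffAt_add hf.contMDiffAt (((hS.contMDiff_smul _).comp hg).contMDiffAt (x := x))
    (.of_forall fun y => (h y).trans (hS.proj_smul _ _).symm)

theorem isSmoothCurve_add (hS : S.IsVectorBundle IA IM) {γ δ : ℝ → A} (hγ : IsSmoothCurve IA γ)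
    (hδ : IsSmoothCurve IA δ) (h : ∀ᶠ t in 𝓝 0, S.proj (γ t) = S.proj (δ t)) :
    IsSmoothCurve IA fun t => S.add (γ t) (δ t) := by
  filter_upwards [hγ, hδ, h.eventually_nhds] with t h1 h2 h3
  exact hS.contMDiffAt_add h1 h2 h3

/-! ### The tangent prolongation on velocities of curves -/

/-- The tangent addition is computed on velocities of curves in `A ×_M A`: although the derivative
within the non-open subset `A ×_M A ⊆ A × A` is a choice, its values on velocities of curves in
that subset are prescribed by the chain rule. -/
theorem velocity_add (hS : S.IsVectorBundle IA IM) {γ δ : ℝ → A} (hγ : IsSmoothCurve IA γ)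
    (hδ : IsSmoothCurve IA δ) (h : ∀ᶠ t in 𝓝 0, S.proj (γ t) = S.proj (δ t)) :
    velocity IA (fun t => S.add (γ t) (δ t)) =
      (S.tangent IA IM).add (velocity IA γ) (velocity IA δ) := by
  obtain ⟨F, hF, hadd⟩ := hS.exists_contMDiffAt_extension_add h.self_of_nhds
  set s : Set (A × A) := {p | S.proj p.1 = S.proj p.2} with hs
  have hmem : (γ 0, δ 0) ∈ s := h.self_of_nhds
  have hd : MDifferentiableWithinAt (IA.prod IA) IA (fun p : A × A => S.add p.1 p.2) s
      (γ 0, δ 0) := by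
    refine (hF.self_of_nhds.mdifferentiableAt (by simp)).mdifferentiableWithinAt
      |>.congr_of_eventuallyEq ?_ (hadd.self_of_nhds hmem)
    filter_upwards [nhdsWithin_le_nhds hadd, self_mem_nhdsWithin] with p h1 h2 using h1 h2
  set J : Set ℝ := {t | S.proj (γ t) = S.proj (δ t)} with hJ
  have hγδ := hγ.prodMk hδ
  have hc := hγδ.mdifferentiableAt.hasMFDerivAt.hasMFDerivWithinAt (s := J)
  have hcomp := (HasMFDerivWithinAt.comp (g := fun p : A × A => S.add p.1 p.2)
    (f := fun t => (γ t, δ t)) (0 : ℝ) hd.hasMFDerivWithinAt hc fun t ht => ht).hasMFDerivAt h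
  refine Bundle.TotalSpace.ext rfl (heq_of_eq ?_)
  have h1 := congrArg (fun L : ℝ →L[ℝ] EA => L 1) hcomp.mfderiv
  have h2 := congrArg (fun L : ℝ →L[ℝ] EA × EA => L 1)
    (mfderiv_prodMk hγ.mdifferentiableAt hδ.mdifferentiableAt)
  exact h1.trans (congrArg (mfderivWithin (IA.prod IA) IA (fun p : A × A => S.add p.1 p.2) s
    (γ 0, δ 0) : EA × EA → EA) h2)

theorem velocity_smul (hS : S.IsVectorBundle IA IM) {γ : ℝ → A} (hγ : IsSmoothCurve IA γ) (r : ℝ) :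
    velocity IA (fun t => S.smul r (γ t)) = (S.tangent IA IM).smul r (velocity IA γ) :=
  velocity_comp hγ ((hS.contMDiff_smul r).mdifferentiableAt (by simp))

theorem velocity_proj (hS : S.IsVectorBundle IA IM) {γ : ℝ → A} (hγ : IsSmoothCurve IA γ) :
    velocity IM (fun t => S.proj (γ t)) = (S.tangent IA IM).proj (velocity IA γ) :=
  velocity_comp hγ (hS.contMDiff_proj.mdifferentiableAt (by simp))

theorem velocity_zero (hS : S.IsVectorBundle IA IM) {m : ℝ → M} (hm : IsSmoothCurve IM m) :
    velocity IA (fun t => S.zero (m t)) = (S.tangent IA IM).zero (velocity IM m) :=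
  velocity_comp hm (hS.contMDiff_zero.mdifferentiableAt (by simp))

theorem velocity_sub (hS : S.IsVectorBundle IA IM) {γ δ : ℝ → A} (hγ : IsSmoothCurve IA γ)
    (hδ : IsSmoothCurve IA δ) (h : ∀ᶠ t in 𝓝 0, S.proj (γ t) = S.proj (δ t)) :
    velocity IA (fun t => S.sub (γ t) (δ t)) =
      (S.tangent IA IM).sub (velocity IA γ) (velocity IA δ) := by
  rw [sub, ← hS.velocity_smul hδ]
  refine hS.velocity_add hγ (hδ.comp_contMDiff (hS.contMDiff_smul _)) ?_
  filter_upwards [h] with t ht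
  rw [hS.proj_smul, ht]

/-- A tangent vector over the velocity of a curve `m` in the base is the velocity of a curve
lying over `m`. -/
theorem exists_isSmoothCurve_lift [IsManifold IA ∞ A] [IA.Boundaryless]
    (hS : S.IsVectorBundle IA IM) {m : ℝ → M}
    (hm : IsSmoothCurve IM m) {v : TangentBundle IA A}
    (hv : (S.tangent IA IM).proj v = velocity IM m) :
    ∃ γ : ℝ → A, IsSmoothCurve IA γ ∧ velocity IA γ = v ∧ ∀ᶠ t in 𝓝 0, S.proj (γ t) = m t := by
  obtain ⟨δ, hδ, rfl⟩ := exists_isSmoothCurve_velocity v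
  rw [← hS.velocity_proj hδ] at hv
  have h0 : S.proj (δ 0) = m 0 := congrArg Bundle.TotalSpace.proj hv
  obtain ⟨n, φ, hb, hφ⟩ := hS.exists_isLinearTrivialization (m 0)
  have hx := hφ.isSmoothCurve_snd hδ (h0 ▸ hb)
  have hγ := hφ.isSmoothCurve_symm hm hx hb
  have hev : ∀ᶠ t in 𝓝 (0 : ℝ), m t ∈ φ.baseSet :=
    hm.continuousAt.eventually (φ.open_baseSet.eventually_mem hb)
  have hproj : ∀ᶠ t in 𝓝 (0 : ℝ),
      S.proj (φ.toOpenPartialHomeomorph.symm (m t, (φ (δ t)).2)) = m t :=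
    hev.mono fun t ht => φ.proj_symm_apply' ht
  refine ⟨_, hγ, ?_, hproj⟩
  refine hφ.velocity_ext hγ hδ (by rwa [hproj.self_of_nhds]) ?_ ?_
  · rw [hv]
    exact velocity_congr hproj
  · exact velocity_congr (hev.mono fun t ht => by
      show (φ (φ.toOpenPartialHomeomorph.symm _)).2 = _
      rw [φ.apply_symm_apply' ht])

/-- Tangent vectors to `A` which can be added are the velocities of curves which can be added. -/
theorem exists_isSmoothCurve_pair [IsManifold IA ∞ A] [IA.Boundaryless]
    (hS : S.IsVectorBundle IA IM) {v w : TangentBundle IA A}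
    (h : (S.tangent IA IM).proj v = (S.tangent IA IM).proj w) :
    ∃ γ δ : ℝ → A, IsSmoothCurve IA γ ∧ IsSmoothCurve IA δ ∧ velocity IA γ = v ∧
      velocity IA δ = w ∧ ∀ᶠ t in 𝓝 0, S.proj (γ t) = S.proj (δ t) := by
  obtain ⟨γ, hγ, rfl⟩ := exists_isSmoothCurve_velocity v
  obtain ⟨δ, hδ, h1, h2⟩ := hS.exists_isSmoothCurve_lift (hγ.comp_contMDiff hS.contMDiff_proj)
    (v := w) (by rw [← h, hS.velocity_proj hγ])
  exact ⟨γ, δ, hγ, hδ, rfl, h1, h2.mono fun t ht => ht.symm⟩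

end IsVectorBundle

end Trivializations

end VBData

/-! ### The tangent prolongation of a vector bundle -/

section TangentVectorSpace

variable {F F' : Type*} [NormedAddCommGroup F] [NormedSpace ℝ F]
  [NormedAddCommGroup F'] [NormedSpace ℝ F']

/-- The identification `TF = F × F` for a vector space `F`, followed by an isomorphism
`F × F ≃ F'`. -/
noncomputable def tangentVectorSpaceEquiv (e : (F × F) ≃L[ℝ] F') : TangentBundle 𝓘(ℝ, F) F ≃ F' :=
  (tangentBundleModelSpaceHomeomorph 𝓘(ℝ, F)).toEquiv.trans e.toEquiv

theorem tangentVectorSpaceEquiv_velocity (e : (F × F) ≃L[ℝ] F') (x : ℝ → F) :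
    tangentVectorSpaceEquiv e (velocity 𝓘(ℝ, F) x) = e (x 0, deriv x 0) := by
  rw [velocity_vectorSpace]
  rfl

theorem contMDiff_tangentVectorSpaceEquiv (e : (F × F) ≃L[ℝ] F') :
    ContMDiff 𝓘(ℝ, F).tangent 𝓘(ℝ, F') ∞ (tangentVectorSpaceEquiv e) := by
  have h : ContMDiff 𝓘(ℝ, F × F) 𝓘(ℝ, F') ∞ e := e.contDiff.contMDiff
  rw [modelWithCornersSelf_prod] at h
  exact ContMDiff.comp (M' := ModelProd F F) (H' := ModelProd F F) h
    contMDiff_tangentBundleModelSpaceHomeomorph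

theorem contMDiff_tangentVectorSpaceEquiv_symm (e : (F × F) ≃L[ℝ] F') :
    ContMDiff 𝓘(ℝ, F') 𝓘(ℝ, F).tangent ∞ (tangentVectorSpaceEquiv e).symm := by
  have h : ContMDiff 𝓘(ℝ, F') 𝓘(ℝ, F × F) ∞ e.symm := e.symm.contDiff.contMDiff
  rw [modelWithCornersSelf_prod] at h
  exact ContMDiff.comp (M' := ModelProd F F) (H' := ModelProd F F)
    contMDiff_tangentBundleModelSpaceHomeomorph_symm h

end TangentVectorSpace

theorem ContMDiffOn.contMDiffOn_tangentMap_of_isOpen {E H M E' H' M' : Type*}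
    [NormedAddCommGroup E] [NormedSpace ℝ E] [TopologicalSpace H]
    [NormedAddCommGroup E'] [NormedSpace ℝ E'] [TopologicalSpace H']
    [TopologicalSpace M] [ChartedSpace H M] [TopologicalSpace M'] [ChartedSpace H' M']
    {I : ModelWithCorners ℝ E H} {I' : ModelWithCorners ℝ E' H'}
    [IsManifold I ∞ M] [IsManifold I' ∞ M'] {f : M → M'} {U : Set M}
    (hf : ContMDiffOn I I' ∞ f U) (hU : IsOpen U) :
    ContMDiffOn I.tangent I'.tangent ∞ (tangentMap I I' f)
      (Bundle.TotalSpace.proj ⁻¹' U : Set (TangentBundle I M)) :=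
  (hf.contMDiffOn_tangentMapWithin (m := ∞) le_rfl hU.uniqueMDiffOn).congr fun _ hv =>
    (tangentMapWithin_eq_tangentMap (hU.uniqueMDiffOn _ hv)
      ((hf.contMDiffAt (hU.mem_nhds hv)).mdifferentiableAt (by simp))).symm

namespace VBData

variable {EA HA A EM HM M F F' EA' HA' A' EM' HM' M' : Type*}
  [NormedAddCommGroup EA] [NormedSpace ℝ EA] [TopologicalSpace HA]
  [NormedAddCommGroup EM] [NormedSpace ℝ EM] [TopologicalSpace HM]
  [NormedAddCommGroup F] [NormedSpace ℝ F] [NormedAddCommGroup F'] [NormedSpace ℝ F']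
  [TopologicalSpace A] [ChartedSpace HA A] [TopologicalSpace M] [ChartedSpace HM M]
  [NormedAddCommGroup EA'] [NormedSpace ℝ EA'] [TopologicalSpace HA']
  [NormedAddCommGroup EM'] [NormedSpace ℝ EM'] [TopologicalSpace HM']
  [TopologicalSpace A'] [ChartedSpace HA' A'] [TopologicalSpace M'] [ChartedSpace HM' M']
  {IA : ModelWithCorners ℝ EA HA} {IM : ModelWithCorners ℝ EM HM} {S : VBData A M}
  {IA' : ModelWithCorners ℝ EA' HA'} {IM' : ModelWithCorners ℝ EM' HM'} {S' : VBData A' M'}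

section

variable [IA.Boundaryless] [IsManifold IA ∞ A] [IM.Boundaryless] [IsManifold IM ∞ M]

namespace IsLinearTrivialization

variable {φ : Bundle.Trivialization F S.proj}

omit [IA.Boundaryless] [IM.Boundaryless] [IsManifold IM ∞ M] in
theorem contMDiffOn_tangentMap_snd (hφ : S.IsLinearTrivialization IA IM φ) :
    ContMDiffOn IA.tangent 𝓘(ℝ, F).tangent ∞ (tangentMap IA 𝓘(ℝ, F) fun a => (φ a).2)
      (Bundle.TotalSpace.proj ⁻¹' φ.source : Set (TangentBundle IA A)) :=
  (contMDiff_snd.comp_contMDiffOn hφ.contMDiffOn).contMDiffOn_tangentMap_of_isOpen φ.open_source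

omit [IA.Boundaryless] [IM.Boundaryless] in
theorem contMDiffOn_tangentMap_symm (hφ : S.IsLinearTrivialization IA IM φ) :
    ContMDiffOn (IM.tangent.prod 𝓘(ℝ, F).tangent) IA.tangent ∞
      (fun p : TangentBundle IM M × TangentBundle 𝓘(ℝ, F) F =>
        tangentMap (IM.prod 𝓘(ℝ, F)) IA φ.toOpenPartialHomeomorph.symm
          ((equivTangentBundleProd IM M 𝓘(ℝ, F) F).symm p))
      {p | p.1.proj ∈ φ.baseSet} :=
  (hφ.contMDiffOn_symm.contMDiffOn_tangentMap_of_isOpen φ.open_target).comp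
    (contMDiff_equivTangentBundleProd_symm (n := ∞)).contMDiffOn fun _ hp => φ.mem_target.2 hp

omit [IM.Boundaryless] [IsManifold IM ∞ M] in
theorem tangentMap_symm_left_inv (hφ : S.IsLinearTrivialization IA IM φ)
    {v : TangentBundle IA A} (hv : S.proj v.proj ∈ φ.baseSet) :
    tangentMap (IM.prod 𝓘(ℝ, F)) IA φ.toOpenPartialHomeomorph.symm
      ((equivTangentBundleProd IM M 𝓘(ℝ, F) F).symm
        (tangentMap IA IM S.proj v, tangentMap IA 𝓘(ℝ, F) (fun a => (φ a).2) v)) = v := by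
  obtain ⟨γ, hγ, rfl⟩ := exists_isSmoothCurve_velocity v
  rw [← velocity_comp hγ
      ((hφ.eventually_contMDiffAt_snd hv).self_of_nhds.mdifferentiableAt (by simp)),
    ← velocity_comp hγ
      ((hφ.eventually_contMDiffAt_proj hv).self_of_nhds.mdifferentiableAt (by simp)),
    hφ.tangentMap_symm_velocity hγ hv]

omit [IA.Boundaryless] [IsManifold IA ∞ A] in
theorem tangentMap_symm_right_inv (hφ : S.IsLinearTrivialization IA IM φ)
    {u : TangentBundle IM M} (hu : u.proj ∈ φ.baseSet) (y : TangentBundle 𝓘(ℝ, F) F) :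
    tangentMap IA IM S.proj (tangentMap (IM.prod 𝓘(ℝ, F)) IA φ.toOpenPartialHomeomorph.symm
      ((equivTangentBundleProd IM M 𝓘(ℝ, F) F).symm (u, y))) = u ∧
    tangentMap IA 𝓘(ℝ, F) (fun a => (φ a).2)
      (tangentMap (IM.prod 𝓘(ℝ, F)) IA φ.toOpenPartialHomeomorph.symm
        ((equivTangentBundleProd IM M 𝓘(ℝ, F) F).symm (u, y))) = y := by
  obtain ⟨m, hm, rfl⟩ := exists_isSmoothCurve_velocity u
  obtain ⟨x, hx, rfl⟩ := exists_isSmoothCurve_velocity y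
  have hγ := hφ.isSmoothCurve_symm hm hx hu
  have h0 : S.proj (φ.toOpenPartialHomeomorph.symm (m 0, x 0)) ∈ φ.baseSet := by
    rw [φ.proj_symm_apply' (b := m 0) hu]
    exact hu
  have hev : ∀ᶠ t in 𝓝 (0 : ℝ), m t ∈ φ.baseSet :=
    hm.continuousAt.eventually (φ.open_baseSet.eventually_mem hu)
  rw [← velocity_prodMk hm hx, ← velocity_comp (hm.prodMk hx)
      ((hφ.eventually_contMDiffAt_symm hu).self_of_nhds.mdifferentiableAt (by simp)),
    ← velocity_comp hγ
      ((hφ.eventually_contMDiffAt_snd h0).self_of_nhds.mdifferentiableAt (by simp)),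
    ← velocity_comp hγ
      ((hφ.eventually_contMDiffAt_proj h0).self_of_nhds.mdifferentiableAt (by simp))]
  exact ⟨velocity_congr (hev.mono fun t ht => φ.proj_symm_apply' ht),
    velocity_congr (hev.mono fun t ht => congrArg Prod.snd (φ.apply_symm_apply' ht))⟩

/-- The derivative of a local trivialization `A|_U ≃ U × F`, as a local trivialization
`TA|_{TU} ≃ TU × TF` of the tangent prolongation, where `TF = F × F` is identified with `F'`. -/
noncomputable def tangentTrivialization (hS : S.IsVectorBundle IA IM)
    (hφ : S.IsLinearTrivialization IA IM φ) (e : (F × F) ≃L[ℝ] F') :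
    Bundle.Trivialization F' (S.tangent IA IM).proj where
  toFun v := (tangentMap IA IM S.proj v,
    tangentVectorSpaceEquiv e (tangentMap IA 𝓘(ℝ, F) (fun a => (φ a).2) v))
  invFun p := tangentMap (IM.prod 𝓘(ℝ, F)) IA φ.toOpenPartialHomeomorph.symm
    ((equivTangentBundleProd IM M 𝓘(ℝ, F) F).symm (p.1, (tangentVectorSpaceEquiv e).symm p.2))
  source := Bundle.TotalSpace.proj ⁻¹' φ.source
  target := (Bundle.TotalSpace.proj ⁻¹' φ.baseSet) ×ˢ univ
  map_source' v hv := ⟨φ.mem_source.1 hv, mem_univ _⟩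
  map_target' p hp := φ.map_target (φ.mem_target.2 hp.1)
  left_inv' v hv := by
    rw [Equiv.symm_apply_apply]
    exact hφ.tangentMap_symm_left_inv (φ.mem_source.1 hv)
  right_inv' p hp := by
    obtain ⟨h1, h2⟩ := hφ.tangentMap_symm_right_inv hp.1 ((tangentVectorSpaceEquiv e).symm p.2)
    rw [h1, h2, Equiv.apply_symm_apply]
  open_source := φ.open_source.preimage (FiberBundle.continuous_proj EA (TangentSpace IA))
  open_target :=
    (φ.open_baseSet.preimage (FiberBundle.continuous_proj EM (TangentSpace IM))).prod isOpen_univ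
  continuousOn_toFun :=
    (hS.contMDiff_proj.contMDiff_tangentMap (m := ∞) le_rfl).continuous.continuousOn.prodMk
      ((contMDiff_tangentVectorSpaceEquiv e).continuous.comp_continuousOn
        hφ.contMDiffOn_tangentMap_snd.continuousOn)
  continuousOn_invFun :=
    hφ.contMDiffOn_tangentMap_symm.continuousOn.comp
      (continuous_fst.prodMk
        ((contMDiff_tangentVectorSpaceEquiv_symm e).continuous.comp
          continuous_snd)).continuousOn fun _ hp => hp.1
  baseSet := Bundle.TotalSpace.proj ⁻¹' φ.baseSet
  open_baseSet := φ.open_baseSet.preimage (FiberBundle.continuous_proj EM (TangentSpace IM))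
  source_eq := by
    ext v
    exact φ.mem_source
  target_eq := rfl
  proj_toFun _ _ := rfl

theorem tangentTrivialization_velocity (hS : S.IsVectorBundle IA IM)
    (hφ : S.IsLinearTrivialization IA IM φ) (e : (F × F) ≃L[ℝ] F') {γ : ℝ → A}
    (hγ : IsSmoothCurve IA γ) (h0 : S.proj (γ 0) ∈ φ.baseSet) :
    (hφ.tangentTrivialization hS e (velocity IA γ)).2 =
      e ((φ (γ 0)).2, deriv (fun t => (φ (γ t)).2) 0) := by
  change tangentVectorSpaceEquiv e (tangentMap IA 𝓘(ℝ, F) (fun a => (φ a).2) (velocity IA γ)) = _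
  rw [← velocity_comp hγ
      ((hφ.eventually_contMDiffAt_snd h0).self_of_nhds.mdifferentiableAt (by simp)),
    tangentVectorSpaceEquiv_velocity]

omit [IA.Boundaryless] [IsManifold IA ∞ A] [IM.Boundaryless] [IsManifold IM ∞ M] in
theorem differentiableAt_snd (hφ : S.IsLinearTrivialization IA IM φ) {γ : ℝ → A}
    (hγ : IsSmoothCurve IA γ) (h0 : S.proj (γ 0) ∈ φ.baseSet) :
    DifferentiableAt ℝ (fun t => (φ (γ t)).2) 0 :=
  (hφ.isSmoothCurve_snd hγ h0).mdifferentiableAt.differentiableAt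

theorem tangent (hS : S.IsVectorBundle IA IM) (hφ : S.IsLinearTrivialization IA IM φ)
    (e : (F × F) ≃L[ℝ] F') :
    (S.tangent IA IM).IsLinearTrivialization IA.tangent IM.tangent
      (hφ.tangentTrivialization hS e) where
  contMDiffOn :=
    (hS.contMDiff_proj.contMDiff_tangentMap (m := ∞) le_rfl).contMDiffOn.prodMk
      ((contMDiff_tangentVectorSpaceEquiv e).comp_contMDiffOn hφ.contMDiffOn_tangentMap_snd)
  contMDiffOn_symm :=
    hφ.contMDiffOn_tangentMap_symm.comp
      (contMDiff_fst.prodMk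
        ((contMDiff_tangentVectorSpaceEquiv_symm e).comp contMDiff_snd)).contMDiffOn
      fun _ hp => hp.1
  snd_zero u hu := by
    obtain ⟨m, hm, rfl⟩ := exists_isSmoothCurve_velocity u
    have hev : ∀ᶠ t in 𝓝 (0 : ℝ), m t ∈ φ.baseSet :=
      hm.continuousAt.eventually (φ.open_baseSet.eventually_mem hu)
    have h0 : (fun t => (φ (S.zero (m t))).2) =ᶠ[𝓝 0] fun _ => 0 :=
      hev.mono fun t ht => hφ.snd_zero _ ht
    rw [← hS.velocity_zero hm, hφ.tangentTrivialization_velocity hS e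
      (hm.comp_contMDiff hS.contMDiff_zero) (by rwa [hS.proj_zero]), h0.deriv_eq,
      hφ.snd_zero (m 0) hu, deriv_const, Prod.mk_zero_zero, map_zero]
  snd_add v w hv h := by
    obtain ⟨γ, δ, hγ, hδ, rfl, rfl, hp⟩ := hS.exists_isSmoothCurve_pair h
    have hv' : S.proj (γ 0) ∈ φ.baseSet := hv
    have hw' : S.proj (δ 0) ∈ φ.baseSet := hp.self_of_nhds ▸ hv'
    have hev : ∀ᶠ t in 𝓝 (0 : ℝ), S.proj (γ t) ∈ φ.baseSet :=
      (hγ.comp_contMDiff hS.contMDiff_proj).continuousAt.eventually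
        (φ.open_baseSet.eventually_mem hv')
    have h0 : (fun t => (φ (S.add (γ t) (δ t))).2) =ᶠ[𝓝 0] fun t => (φ (γ t)).2 + (φ (δ t)).2 := by
      filter_upwards [hev, hp] with t ht hpt using hφ.snd_add _ _ ht hpt
    rw [← hS.velocity_add hγ hδ hp, hφ.tangentTrivialization_velocity hS e
        (hS.isSmoothCurve_add hγ hδ hp) (by rwa [hS.proj_add _ _ hp.self_of_nhds]),
      hφ.tangentTrivialization_velocity hS e hγ hv', hφ.tangentTrivialization_velocity hS e hδ hw',
      h0.deriv_eq, hφ.snd_add _ _ hv' hp.self_of_nhds,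
      deriv_fun_add (hφ.differentiableAt_snd hγ hv') (hφ.differentiableAt_snd hδ hw'),
      ← map_add, Prod.mk_add_mk]
  snd_smul r v hv := by
    obtain ⟨γ, hγ, rfl⟩ := exists_isSmoothCurve_velocity v
    have hv' : S.proj (γ 0) ∈ φ.baseSet := hv
    have hev : ∀ᶠ t in 𝓝 (0 : ℝ), S.proj (γ t) ∈ φ.baseSet :=
      (hγ.comp_contMDiff hS.contMDiff_proj).continuousAt.eventually
        (φ.open_baseSet.eventually_mem hv')
    have h0 : (fun t => (φ (S.smul r (γ t))).2) =ᶠ[𝓝 0] fun t => r • (φ (γ t)).2 := by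
      filter_upwards [hev] with t ht using hφ.snd_smul _ _ ht
    rw [← hS.velocity_smul hγ, hφ.tangentTrivialization_velocity hS e
        (hγ.comp_contMDiff (hS.contMDiff_smul r)) (by rwa [hS.proj_smul]),
      hφ.tangentTrivialization_velocity hS e hγ hv', h0.deriv_eq, hφ.snd_smul _ _ hv',
      deriv_fun_const_smul _ (hφ.differentiableAt_snd hγ hv'), ← map_smul, Prod.smul_mk]

end IsLinearTrivialization

theorem IsVectorBundle.tangent (hS : S.IsVectorBundle IA IM) :
    (S.tangent IA IM).IsVectorBundle IA.tangent IM.tangent where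
  proj_zero u := by
    obtain ⟨m, hm, rfl⟩ := exists_isSmoothCurve_velocity u
    rw [← hS.velocity_zero hm, ← hS.velocity_proj (hm.comp_contMDiff hS.contMDiff_zero)]
    simp only [hS.proj_zero]
  proj_add v w h := by
    obtain ⟨γ, δ, hγ, hδ, rfl, rfl, hp⟩ := hS.exists_isSmoothCurve_pair h
    rw [← hS.velocity_add hγ hδ hp, ← hS.velocity_proj (hS.isSmoothCurve_add hγ hδ hp),
      ← hS.velocity_proj hγ]
    exact velocity_congr (hp.mono fun t ht => hS.proj_add _ _ ht)
  proj_smul r v := by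
    obtain ⟨γ, hγ, rfl⟩ := exists_isSmoothCurve_velocity v
    rw [← hS.velocity_smul hγ, ← hS.velocity_proj (hγ.comp_contMDiff (hS.contMDiff_smul r)),
      ← hS.velocity_proj hγ]
    simp only [hS.proj_smul]
  exists_trivialization u := by
    obtain ⟨n, φ, hm, hφ⟩ := hS.exists_isLinearTrivialization u.proj
    let e : (EuclideanSpace ℝ (Fin n) × EuclideanSpace ℝ (Fin n)) ≃L[ℝ]
        EuclideanSpace ℝ (Fin (n + n)) :=
      ContinuousLinearEquiv.ofFinrankEq (by simp)
    have h := hφ.tangent hS e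
    exact ⟨n + n, hφ.tangentTrivialization hS e, hm, h.contMDiffOn, h.contMDiffOn_symm,
      h.snd_zero, h.snd_add, h.snd_smul⟩

omit [IM.Boundaryless] [IsManifold IM ∞ M] in
/-- The tangent map of a smooth fibrewise linear map is fibrewise linear. -/
theorem IsLinearOver.tangent (hS : S.IsVectorBundle IA IM) (hS' : S'.IsVectorBundle IA' IM')
    {f : A → A'} {g : M → M'} (h : S.IsLinearOver S' f g) (hf : ContMDiff IA IA' ∞ f)
    (hg : ContMDiff IM IM' ∞ g) :
    (S.tangent IA IM).IsLinearOver (S'.tangent IA' IM') (tangentMap IA IA' f)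
      (tangentMap IM IM' g) where
  proj v := by
    obtain ⟨γ, hγ, rfl⟩ := exists_isSmoothCurve_velocity v
    rw [← velocity_comp hγ (hf.mdifferentiableAt (by simp)),
      ← hS'.velocity_proj (hγ.comp_contMDiff hf), ← hS.velocity_proj hγ,
      ← velocity_comp (hγ.comp_contMDiff hS.contMDiff_proj) (hg.mdifferentiableAt (by simp))]
    simp only [h.proj]
  add v w hvw := by
    obtain ⟨γ, δ, hγ, hδ, rfl, rfl, hp⟩ := hS.exists_isSmoothCurve_pair hvw
    rw [← hS.velocity_add hγ hδ hp,
      ← velocity_comp (hS.isSmoothCurve_add hγ hδ hp) (hf.mdifferentiableAt (by simp)),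
      ← velocity_comp hγ (hf.mdifferentiableAt (by simp)),
      ← velocity_comp hδ (hf.mdifferentiableAt (by simp)),
      ← hS'.velocity_add (hγ.comp_contMDiff hf) (hδ.comp_contMDiff hf)
        (hp.mono fun t ht => by rw [h.proj, h.proj, ht])]
    exact velocity_congr (hp.mono fun t ht => h.add _ _ ht)
  smul r v := by
    obtain ⟨γ, hγ, rfl⟩ := exists_isSmoothCurve_velocity v
    rw [← hS.velocity_smul hγ, ← velocity_comp hγ (hf.mdifferentiableAt (by simp)),
      ← velocity_comp (hγ.comp_contMDiff (hS.contMDiff_smul r)) (hf.mdifferentiableAt (by simp)),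
      ← hS'.velocity_smul (hγ.comp_contMDiff hf)]
    simp only [h.smul]

end

end VBData

/-! ### Lifting curves along fibrewise surjective morphisms -/

section LinearAlgebra

variable {F G : Type*} [NormedAddCommGroup F] [NormedSpace ℝ F] [FiniteDimensional ℝ F]
  [NormedAddCommGroup G] [NormedSpace ℝ G] [FiniteDimensional ℝ G]

omit [FiniteDimensional ℝ G] in
/-- A family of linear maps which depends smoothly on `t` pointwise depends smoothly on `t` as a
family of operators. -/
theorem exists_clm_of_eventually_isLinearMap {L : ℝ → F → G}
    (hlin : ∀ᶠ t in 𝓝 (0 : ℝ), IsLinearMap ℝ (L t))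
    (hL : ∀ x, ∀ᶠ t in 𝓝 (0 : ℝ), ContDiffAt ℝ ∞ (fun s => L s x) t) :
    ∃ N : ℝ → F →L[ℝ] G, (∀ᶠ t in 𝓝 (0 : ℝ), ContDiffAt ℝ ∞ N t) ∧
      ∀ᶠ t in 𝓝 (0 : ℝ), ∀ x, N t x = L t x := by
  let b := Module.finBasis ℝ F
  refine ⟨fun t => ∑ i, (LinearMap.toContinuousLinearMap (b.coord i)).smulRight (L t (b i)), ?_, ?_⟩
  · filter_upwards [eventually_all.2 fun i => hL (b i)] with t ht
    refine ContDiffAt.sum fun i _ => ?_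
    exact ((ContinuousLinearMap.smulRightL ℝ F G
      (LinearMap.toContinuousLinearMap (b.coord i))).contDiff.contDiffAt).comp t (ht i)
  · filter_upwards [hlin] with t ht x
    have h := congrArg (ht.mk' (L t)) (b.sum_repr x)
    rw [map_sum] at h
    simpa using! h

/-- A linear equation `L_t x = y_t` with smooth coefficients, with `L_0` surjective and with the
solution `x₀(0)` at `t = 0`, has a smooth solution through `x₀(0)`. If `x₀` is already a solution
up to first order, then the solution can be taken tangent to `x₀`. -/
theorem exists_isSmoothCurve_solution {L : ℝ → F → G}
    (hlin : ∀ᶠ t in 𝓝 (0 : ℝ), IsLinearMap ℝ (L t))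
    (hL : ∀ x, ∀ᶠ t in 𝓝 (0 : ℝ), ContDiffAt ℝ ∞ (fun s => L s x) t)
    (hsurj : Function.Surjective (L 0)) {x₀ : ℝ → F} {y : ℝ → G}
    (hx₀ : ∀ᶠ t in 𝓝 (0 : ℝ), ContDiffAt ℝ ∞ x₀ t) (hy : ∀ᶠ t in 𝓝 (0 : ℝ), ContDiffAt ℝ ∞ y t)
    (h0 : L 0 (x₀ 0) = y 0) :
    ∃ x : ℝ → F, (∀ᶠ t in 𝓝 (0 : ℝ), ContDiffAt ℝ ∞ x t) ∧ x 0 = x₀ 0 ∧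
      (∀ᶠ t in 𝓝 (0 : ℝ), L t (x t) = y t) ∧
      (deriv (fun t => L t (x₀ t)) 0 = deriv y 0 → deriv x 0 = deriv x₀ 0) := by
  obtain ⟨N, hN, hNL⟩ := exists_clm_of_eventually_isLinearMap hlin hL
  have hsurj' : LinearMap.range (N 0 : F →ₗ[ℝ] G) = ⊤ :=
    LinearMap.range_eq_top.2 fun z => (hsurj z).imp fun x hx => (hNL.self_of_nhds x).trans hx
  obtain ⟨R, hR⟩ := (N 0 : F →ₗ[ℝ] G).exists_rightInverse_of_surjective hsurj'
  let R' : G →L[ℝ] F := LinearMap.toContinuousLinearMap R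
  -- `N_t ∘ R'` is the identity at `t = 0`, hence invertible for small `t`.
  let P : ℝ → G →L[ℝ] G := fun t => (N t).comp R'
  have hP : ∀ᶠ t in 𝓝 (0 : ℝ), ContDiffAt ℝ ∞ P t :=
    hN.mono fun t ht => ht.clm_comp contDiffAt_const
  have hP0 : P 0 = 1 := by
    ext z
    exact LinearMap.congr_fun hR z
  have hunit : ∀ᶠ t in 𝓝 (0 : ℝ), IsUnit (P t) := by
    have h : IsUnit (P 0) := hP0 ▸ isUnit_one
    exact hP.self_of_nhds.continuousAt.eventually (Units.isOpen.eventually_mem h)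
  have hinv : ∀ᶠ t in 𝓝 (0 : ℝ), ContDiffAt ℝ ∞ (fun s => Ring.inverse (P s)) t := by
    filter_upwards [hP, hunit] with t h1 h2
    obtain ⟨u, hu⟩ := h2
    exact ContDiffAt.comp t (hu ▸ contDiffAt_ringInverse ℝ u) h1
  let r : ℝ → G := fun t => y t - N t (x₀ t)
  have hr : ∀ᶠ t in 𝓝 (0 : ℝ), ContDiffAt ℝ ∞ r t := by
    filter_upwards [hN, hx₀, hy] with t h1 h2 h3 using h3.sub (h1.clm_apply h2)
  have hr0 : r 0 = 0 := by simp [r, hNL.self_of_nhds, h0]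
  let K : ℝ → G →L[ℝ] F := fun t => R'.comp (Ring.inverse (P t))
  have hK : ∀ᶠ t in 𝓝 (0 : ℝ), ContDiffAt ℝ ∞ K t :=
    hinv.mono fun t ht => contDiffAt_const.clm_comp ht
  refine ⟨fun t => x₀ t + K t (r t), ?_, by simp [hr0], ?_, fun hd => ?_⟩
  · filter_upwards [hx₀, hK, hr] with t h1 h2 h3 using h1.add (h2.clm_apply h3)
  · filter_upwards [hunit, hNL] with t h1 h2
    have h3 : N t (K t (r t)) = r t :=
      DFunLike.congr_fun (Ring.mul_inverse_cancel (P t) h1) (r t)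
    rw [← h2, map_add, h3]
    exact add_sub_cancel _ _
  · have hx₀' := hx₀.self_of_nhds.differentiableAt (by simp)
    have hy' := hy.self_of_nhds.differentiableAt (by simp)
    have hNx : DifferentiableAt ℝ (fun t => N t (x₀ t)) 0 :=
      (hN.self_of_nhds.clm_apply hx₀.self_of_nhds).differentiableAt (by simp)
    have hNd : deriv (fun t => N t (x₀ t)) 0 = deriv y 0 := by
      rw [← hd]
      exact EventuallyEq.deriv_eq (hNL.mono fun t ht => ht _)
    have hr' : HasDerivAt r 0 0 := by
      have := hy'.hasDerivAt.sub hNx.hasDerivAt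
      rwa [hNd, sub_self] at this
    have hKr := (hK.self_of_nhds.differentiableAt (by simp)).hasDerivAt.clm_apply hr'
    have h := hx₀'.hasDerivAt.add hKr
    rw [hr0, map_zero, map_zero, add_zero, add_zero] at h
    exact h.deriv

end LinearAlgebra

namespace VBData

variable {EA HA A EM HM M F EA' HA' A' EM' HM' M' : Type*}
  [NormedAddCommGroup EA] [NormedSpace ℝ EA] [TopologicalSpace HA]
  [NormedAddCommGroup EM] [NormedSpace ℝ EM] [TopologicalSpace HM]
  [NormedAddCommGroup F] [NormedSpace ℝ F]
  [TopologicalSpace A] [ChartedSpace HA A] [TopologicalSpace M] [ChartedSpace HM M]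
  [NormedAddCommGroup EA'] [NormedSpace ℝ EA'] [TopologicalSpace HA']
  [NormedAddCommGroup EM'] [NormedSpace ℝ EM'] [TopologicalSpace HM']
  [TopologicalSpace A'] [ChartedSpace HA' A'] [TopologicalSpace M'] [ChartedSpace HM' M']
  {IA : ModelWithCorners ℝ EA HA} {IM : ModelWithCorners ℝ EM HM} {S : VBData A M}
  {IA' : ModelWithCorners ℝ EA' HA'} {IM' : ModelWithCorners ℝ EM' HM'} {S' : VBData A' M'}

namespace IsLinearTrivialization

variable {φ : Bundle.Trivialization F S.proj}

theorem symm_add (hS : S.IsVectorBundle IA IM) (hφ : S.IsLinearTrivialization IA IM φ) {m : M}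
    (hm : m ∈ φ.baseSet) (x y : F) :
    φ.toOpenPartialHomeomorph.symm (m, x + y) =
      S.add (φ.toOpenPartialHomeomorph.symm (m, x)) (φ.toOpenPartialHomeomorph.symm (m, y)) := by
  have hp (z : F) : S.proj (φ.toOpenPartialHomeomorph.symm (m, z)) = m := φ.proj_symm_apply' hm
  have hxy : S.proj (φ.toOpenPartialHomeomorph.symm (m, x)) =
      S.proj (φ.toOpenPartialHomeomorph.symm (m, y)) := by rw [hp, hp]
  refine trivialization_ext φ (by rwa [hp]) (by rw [hS.proj_add _ _ hxy, hp, hp]) ?_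
  rw [hφ.snd_add _ _ (by rwa [hp]) hxy]
  simp only [φ.apply_symm_apply' hm]

theorem symm_smul (hS : S.IsVectorBundle IA IM) (hφ : S.IsLinearTrivialization IA IM φ) {m : M}
    (hm : m ∈ φ.baseSet) (r : ℝ) (x : F) :
    φ.toOpenPartialHomeomorph.symm (m, r • x) =
      S.smul r (φ.toOpenPartialHomeomorph.symm (m, x)) := by
  have hp (z : F) : S.proj (φ.toOpenPartialHomeomorph.symm (m, z)) = m := φ.proj_symm_apply' hm
  refine trivialization_ext φ (by rwa [hp]) (by rw [hS.proj_smul, hp, hp]) ?_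
  rw [hφ.snd_smul _ _ (by rwa [hp])]
  simp only [φ.apply_symm_apply' hm]

end IsLinearTrivialization

theorem deriv_eq_of_velocity_eq {x y : ℝ → F} (h : velocity 𝓘(ℝ, F) x = velocity 𝓘(ℝ, F) y) :
    deriv x 0 = deriv y 0 := by
  rw [velocity_vectorSpace, velocity_vectorSpace] at h
  exact congrArg (fun w : TangentBundle 𝓘(ℝ, F) F => (w.2 : F)) h

theorem velocity_eq_of_deriv_eq {x y : ℝ → F} (h0 : x 0 = y 0) (h : deriv x 0 = deriv y 0) :
    velocity 𝓘(ℝ, F) x = velocity 𝓘(ℝ, F) y :=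
  (velocity_vectorSpace_eq h0 h).trans (velocity_vectorSpace y).symm

theorem IsVectorBundle.exists_isSmoothCurve_lift_through (hS : S.IsVectorBundle IA IM) {m : ℝ → M}
    (hm : IsSmoothCurve IM m) {a : A} (ha : S.proj a = m 0) :
    ∃ γ : ℝ → A, IsSmoothCurve IA γ ∧ γ 0 = a ∧ ∀ᶠ t in 𝓝 0, S.proj (γ t) = m t := by
  obtain ⟨n, φ, hb, hφ⟩ := hS.exists_isLinearTrivialization (m 0)
  refine ⟨_, hφ.isSmoothCurve_symm hm (.const (φ a).2) hb, ?_, ?_⟩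
  · simp only [← ha]
    exact φ.symm_apply_mk_proj (φ.mem_source.2 (ha ▸ hb))
  · filter_upwards [hm.continuousAt.eventually (φ.open_baseSet.eventually_mem hb)] with t ht
    exact φ.proj_symm_apply' ht

/-- Let `f : A → A'` be a morphism of vector bundles over `g : M → M'` which is surjective on
fibres. A curve `γ` in `A` with `f (γ 0) = δ 0` can be moved within the fibres of `A` so that it
lifts the curve `δ` in `A'`; it keeps its velocity if `f ∘ γ` and `δ` have the same velocity. -/
theorem IsLinearOver.exists_isSmoothCurve_lift (hS : S.IsVectorBundle IA IM)
    (hS' : S'.IsVectorBundle IA' IM') {f : A → A'} {g : M → M'} (h : S.IsLinearOver S' f g)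
    (hf : ContMDiff IA IA' ∞ f) (hg : ContMDiff IM IM' ∞ g)
    (hsurj : ∀ m a', g m = S'.proj a' → ∃ a, S.proj a = m ∧ f a = a')
    {γ : ℝ → A} {δ : ℝ → A'} (hγ : IsSmoothCurve IA γ) (hδ : IsSmoothCurve IA' δ)
    (hγδ : ∀ᶠ t in 𝓝 0, S'.proj (δ t) = g (S.proj (γ t))) (h0 : f (γ 0) = δ 0) :
    ∃ ε : ℝ → A, IsSmoothCurve IA ε ∧ ε 0 = γ 0 ∧ (∀ᶠ t in 𝓝 0, S.proj (ε t) = S.proj (γ t)) ∧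
      (∀ᶠ t in 𝓝 0, f (ε t) = δ t) ∧
      (velocity IA' (fun t => f (γ t)) = velocity IA' δ → velocity IA ε = velocity IA γ) := by
  have hm : IsSmoothCurve IM fun t => S.proj (γ t) := hγ.comp_contMDiff hS.contMDiff_proj
  obtain ⟨n, φ, hb, hφ⟩ := hS.exists_isLinearTrivialization (S.proj (γ 0))
  obtain ⟨k, ψ, hb', hψ⟩ := hS'.exists_isLinearTrivialization (g (S.proj (γ 0)))
  have hev : ∀ᶠ t in 𝓝 (0 : ℝ), S.proj (γ t) ∈ φ.baseSet :=
    hm.continuousAt.eventually (φ.open_baseSet.eventually_mem hb)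
  have hev' : ∀ᶠ t in 𝓝 (0 : ℝ), g (S.proj (γ t)) ∈ ψ.baseSet :=
    (hm.comp_contMDiff hg).continuousAt.eventually (ψ.open_baseSet.eventually_mem hb')
  -- The morphism `f` along the base curve of `γ`, in the trivializations `φ` and `ψ`.
  let L : ℝ → EuclideanSpace ℝ (Fin n) → EuclideanSpace ℝ (Fin k) := fun t x =>
    (ψ (f (φ.toOpenPartialHomeomorph.symm (S.proj (γ t), x)))).2
  have hpf {t : ℝ} (ht : S.proj (γ t) ∈ φ.baseSet) (x : EuclideanSpace ℝ (Fin n)) :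
      S'.proj (f (φ.toOpenPartialHomeomorph.symm (S.proj (γ t), x))) = g (S.proj (γ t)) := by
    rw [h.proj, φ.proj_symm_apply' ht]
  have hlin : ∀ᶠ t in 𝓝 (0 : ℝ), IsLinearMap ℝ (L t) := by
    filter_upwards [hev, hev'] with t ht ht'
    refine ⟨fun x y => ?_, fun r x => ?_⟩
    · simp only [L]
      rw [hφ.symm_add hS ht, h.add _ _ (by rw [φ.proj_symm_apply' ht, φ.proj_symm_apply' ht]),
        hψ.snd_add _ _ (by rwa [hpf ht]) (by rw [hpf ht, hpf ht])]
    · simp only [L]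
      rw [hφ.symm_smul hS ht, h.smul, hψ.snd_smul _ _ (by rwa [hpf ht])]
  have hL (x) : ∀ᶠ t in 𝓝 (0 : ℝ), ContDiffAt ℝ ∞ (fun s => L s x) t :=
    isSmoothCurve_iff_contDiffAt.1 <| hψ.isSmoothCurve_snd
      ((hφ.isSmoothCurve_symm hm (.const x) hb).comp_contMDiff hf) (by rwa [hpf hb])
  have hsurj0 : Function.Surjective (L 0) := by
    intro y
    obtain ⟨a, ha, hfa⟩ := hsurj (S.proj (γ 0))
      (ψ.toOpenPartialHomeomorph.symm (g (S.proj (γ 0)), y)) (ψ.proj_symm_apply' hb').symm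
    refine ⟨(φ a).2, ?_⟩
    simp only [L]
    rw [← ha, φ.symm_apply_mk_proj (φ.mem_source.2 (ha ▸ hb)), hfa, ψ.apply_symm_apply' hb']
  have hLγ : ∀ᶠ t in 𝓝 (0 : ℝ), L t (φ (γ t)).2 = (ψ (f (γ t))).2 := by
    filter_upwards [hev] with t ht
    simp only [L]
    rw [φ.symm_apply_mk_proj (φ.mem_source.2 ht)]
  have hb'' : S'.proj (δ 0) ∈ ψ.baseSet := hγδ.self_of_nhds ▸ hb'
  have hx₀ := hφ.isSmoothCurve_snd hγ hb
  have hy := hψ.isSmoothCurve_snd hδ hb''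
  obtain ⟨x, hx, hx0, hLx, hdx⟩ := exists_isSmoothCurve_solution hlin hL hsurj0
    (isSmoothCurve_iff_contDiffAt.1 hx₀) (isSmoothCurve_iff_contDiffAt.1 hy)
    (by rw [hLγ.self_of_nhds, h0])
  have hε := hφ.isSmoothCurve_symm hm (isSmoothCurve_iff_contDiffAt.2 hx) hb
  have hproj : ∀ᶠ t in 𝓝 (0 : ℝ),
      S.proj (φ.toOpenPartialHomeomorph.symm (S.proj (γ t), x t)) = S.proj (γ t) :=
    hev.mono fun t ht => φ.proj_symm_apply' ht
  refine ⟨_, hε, ?_, hproj, ?_, fun hv => ?_⟩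
  · rw [hx0, φ.symm_apply_mk_proj (φ.mem_source.2 hb)]
  · filter_upwards [hev, hev', hLx, hγδ] with t h1 h2 h3 h4
    exact trivialization_ext ψ (by rwa [hpf h1]) (by rw [hpf h1, h4]) h3
  · refine hφ.velocity_ext hε hγ (by rwa [hproj.self_of_nhds]) (velocity_congr hproj) ?_
    have hd : deriv (fun t => L t (φ (γ t)).2) 0 = deriv (fun t => (ψ (δ t)).2) 0 := by
      rw [EventuallyEq.deriv_eq hLγ]
      refine deriv_eq_of_velocity_eq ?_
      have hψd := (hψ.eventually_contMDiffAt_snd hb'').self_of_nhds.mdifferentiableAt (by simp)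
      rw [velocity_comp hδ hψd, ← hv, ← velocity_comp (hγ.comp_contMDiff hf) (h0 ▸ hψd)]
    have hsnd : ∀ᶠ t in 𝓝 (0 : ℝ),
        (φ (φ.toOpenPartialHomeomorph.symm (S.proj (γ t), x t))).2 = x t :=
      hev.mono fun t ht => by rw [φ.apply_symm_apply' ht]
    exact (velocity_congr hsnd).trans
      (velocity_eq_of_deriv_eq hx0 (hdx hd))

/-- A morphism of vector bundles which is surjective on fibres is a submersion onto the pullback
of its target to the base of its source. -/
theorem IsLinearOver.exists_tangentMap_eq [IM.Boundaryless] [IsManifold IM ∞ M]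
    [IA'.Boundaryless] [IsManifold IA' ∞ A'] (hS : S.IsVectorBundle IA IM)
    (hS' : S'.IsVectorBundle IA' IM') {f : A → A'} {g : M → M'} (h : S.IsLinearOver S' f g)
    (hf : ContMDiff IA IA' ∞ f) (hg : ContMDiff IM IM' ∞ g)
    (hsurj : ∀ m a', g m = S'.proj a' → ∃ a, S.proj a = m ∧ f a = a')
    {a : A} {v : TangentBundle IM M} {w : TangentBundle IA' A'} (hv : v.proj = S.proj a)
    (hw : w.proj = f a) (hvw : tangentMap IM IM' g v = tangentMap IA' IM' S'.proj w) :
    ∃ z : TangentBundle IA A, z.proj = a ∧ tangentMap IA IM S.proj z = v ∧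
      tangentMap IA IA' f z = w := by
  obtain ⟨m, hm, rfl⟩ := exists_isSmoothCurve_velocity v
  rw [← velocity_comp hm (hg.mdifferentiableAt (by simp))] at hvw
  obtain ⟨δ, hδ, rfl, hδm⟩ := hS'.exists_isSmoothCurve_lift (hm.comp_contMDiff hg) hvw.symm
  obtain ⟨γ, hγ, rfl, hγm⟩ := hS.exists_isSmoothCurve_lift_through hm hv.symm
  obtain ⟨ε, hε, hε0, hεm, hεδ, -⟩ := h.exists_isSmoothCurve_lift hS hS' hf hg hsurj hγ hδ
    (by filter_upwards [hδm, hγm] with t h1 h2; rw [h1, h2]) hw.symm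
  refine ⟨velocity IA ε, hε0, ?_, ?_⟩
  · rw [← velocity_comp hε (hS.contMDiff_proj.mdifferentiableAt (by simp))]
    refine velocity_congr ?_
    filter_upwards [hεm, hγm] with t h1 h2 using h1.trans h2
  · rw [← velocity_comp hε (hf.mdifferentiableAt (by simp))]
    exact velocity_congr hεδ

end VBData

/-! ### The tangent square of a double vector bundle -/

namespace DVBData

variable {ED HD D EA HA A EB HB B EM HM M : Type*}
  [NormedAddCommGroup ED] [NormedSpace ℝ ED] [TopologicalSpace HD]
  [NormedAddCommGroup EA] [NormedSpace ℝ EA] [TopologicalSpace HA]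
  [NormedAddCommGroup EB] [NormedSpace ℝ EB] [TopologicalSpace HB]
  [NormedAddCommGroup EM] [NormedSpace ℝ EM] [TopologicalSpace HM]
  [TopologicalSpace D] [ChartedSpace HD D] [TopologicalSpace A] [ChartedSpace HA A]
  [TopologicalSpace B] [ChartedSpace HB B] [TopologicalSpace M] [ChartedSpace HM M]
  {ID : ModelWithCorners ℝ ED HD} {IA : ModelWithCorners ℝ EA HA}
  {IB : ModelWithCorners ℝ EB HB} {IM : ModelWithCorners ℝ EM HM} {Q : DVBData D A B M}

namespace IsDoubleVectorBundle

theorem sideA_proj_overA (hQ : Q.IsDoubleVectorBundle ID IA IB IM) (d : D) :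
    Q.sideA.proj (Q.overA.proj d) = Q.sideB.proj (Q.overB.proj d) :=
  (hQ.proj_overB.proj d).symm

/-- A curve of compatible pairs in `A ×_M B` lifts to a curve in `D` with a prescribed velocity. -/
theorem exists_isSmoothCurve_lift [ID.Boundaryless] [IsManifold ID ∞ D]
    (hQ : Q.IsDoubleVectorBundle ID IA IB IM) {α : ℝ → A} {β : ℝ → B} (hα : IsSmoothCurve IA α)
    (hβ : IsSmoothCurve IB β) (hαβ : ∀ᶠ t in 𝓝 0, Q.sideA.proj (α t) = Q.sideB.proj (β t))
    {z : TangentBundle ID D} (hzα : tangentMap ID IA Q.overA.proj z = velocity IA α)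
    (hzβ : tangentMap ID IB Q.overB.proj z = velocity IB β) :
    ∃ γ : ℝ → D, IsSmoothCurve ID γ ∧ velocity ID γ = z ∧
      (∀ᶠ t in 𝓝 0, Q.overA.proj (γ t) = α t) ∧ ∀ᶠ t in 𝓝 0, Q.overB.proj (γ t) = β t := by
  obtain ⟨δ, hδ, rfl, hδα⟩ := hQ.vb_overA.exists_isSmoothCurve_lift hα hzα
  have hδβ : velocity IB (fun t => Q.overB.proj (δ t)) = velocity IB β :=
    (hQ.vb_overB.velocity_proj hδ).trans hzβ
  obtain ⟨γ, hγ, -, hγA, hγB, hγv⟩ := hQ.proj_overB.exists_isSmoothCurve_lift hQ.vb_overA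
    hQ.vb_sideB hQ.vb_overB.contMDiff_proj hQ.vb_sideA.contMDiff_proj hQ.surjective hδ hβ
    (by filter_upwards [hαβ, hδα] with t h1 h2; rw [h2, h1])
    (congrArg Bundle.TotalSpace.proj hδβ)
  refine ⟨γ, hγ, hγv hδβ, ?_, hγB⟩
  filter_upwards [hγA, hδα] with t h1 h2 using h1.trans h2

/-- The interchange law of the tangent square: four tangent vectors as in the law are the
velocities of four curves as in the law. -/
theorem tangent_interchange [ID.Boundaryless] [IsManifold ID ∞ D]
    (hQ : Q.IsDoubleVectorBundle ID IA IB IM)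
    (d₁ d₂ d₃ d₄ : TangentBundle ID D)
    (h12 : (Q.overA.tangent ID IA).proj d₁ = (Q.overA.tangent ID IA).proj d₂)
    (h34 : (Q.overA.tangent ID IA).proj d₃ = (Q.overA.tangent ID IA).proj d₄)
    (h13 : (Q.overB.tangent ID IB).proj d₁ = (Q.overB.tangent ID IB).proj d₃)
    (h24 : (Q.overB.tangent ID IB).proj d₂ = (Q.overB.tangent ID IB).proj d₄) :
    (Q.overB.tangent ID IB).add ((Q.overA.tangent ID IA).add d₁ d₂)
        ((Q.overA.tangent ID IA).add d₃ d₄) =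
      (Q.overA.tangent ID IA).add ((Q.overB.tangent ID IB).add d₁ d₃)
        ((Q.overB.tangent ID IB).add d₂ d₄) := by
  have hA := hQ.vb_overA
  have hB := hQ.vb_overB
  obtain ⟨γ₁, γ₂, hγ₁, hγ₂, rfl, rfl, e12⟩ := hA.exists_isSmoothCurve_pair h12
  obtain ⟨γ₃, hγ₃, rfl, e13⟩ := hB.exists_isSmoothCurve_lift
    (hγ₁.comp_contMDiff hB.contMDiff_proj) (h13.symm.trans (hB.velocity_proj hγ₁).symm)
  obtain ⟨γ₄, hγ₄, rfl, e34, e24⟩ := hQ.exists_isSmoothCurve_lift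
    (hγ₃.comp_contMDiff hA.contMDiff_proj) (hγ₂.comp_contMDiff hB.contMDiff_proj)
    (by
      filter_upwards [e12, e13] with t h1 h2
      rw [hQ.sideA_proj_overA, h2, ← hQ.sideA_proj_overA, h1, hQ.sideA_proj_overA])
    (h34.symm.trans (hA.velocity_proj hγ₃).symm) (h24.symm.trans (hB.velocity_proj hγ₂).symm)
  have e34' := e34.mono fun t ht => ht.symm
  have e13' := e13.mono fun t ht => ht.symm
  have e24' := e24.mono fun t ht => ht.symm
  rw [← hA.velocity_add hγ₁ hγ₂ e12, ← hA.velocity_add hγ₃ hγ₄ e34',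
    ← hB.velocity_add hγ₁ hγ₃ e13', ← hB.velocity_add hγ₂ hγ₄ e24',
    ← hB.velocity_add (hA.isSmoothCurve_add hγ₁ hγ₂ e12) (hA.isSmoothCurve_add hγ₃ hγ₄ e34'),
    ← hA.velocity_add (hB.isSmoothCurve_add hγ₁ hγ₃ e13') (hB.isSmoothCurve_add hγ₂ hγ₄ e24')]
  · refine velocity_congr ?_
    filter_upwards [e12, e34', e13', e24'] with t h1 h2 h3 h4
    exact hQ.interchange _ _ _ _ h1 h2 h3 h4
  · filter_upwards [e12, e34', e13', e24'] with t h1 h2 h3 h4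
    rw [hQ.proj_overA.add _ _ h3, hQ.proj_overA.add _ _ h4, h1, h2]
  · filter_upwards [e12, e34', e13', e24'] with t h1 h2 h3 h4
    rw [hQ.proj_overB.add _ _ h1, hQ.proj_overB.add _ _ h2, h3, h4]

theorem tangent_surjective (hQ : Q.IsDoubleVectorBundle ID IA IB IM) (v : TangentBundle IA A)
    (w : TangentBundle IB B)
    (h : tangentMap IA IM Q.sideA.proj v = tangentMap IB IM Q.sideB.proj w) :
    ∃ z : TangentBundle ID D,
      tangentMap ID IA Q.overA.proj z = v ∧ tangentMap ID IB Q.overB.proj z = w := by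
  obtain ⟨d, hdv, hdw⟩ := hQ.surjective v.proj w.proj (congrArg Bundle.TotalSpace.proj h)
  obtain ⟨z, -, hzv, hzw⟩ := hQ.submersion d v w hdv.symm hdw.symm h
  exact ⟨z, hzv, hzw⟩

/-- The tangent square is a double vector bundle. Each compatibility condition is the linearity of
a smooth map, which the tangent functor preserves, except for the interchange law and the two
conditions on `TD → TA ×_{TM} TB`. This map is onto because `D → A ×_M B` is a surjective
submersion, and it is a submersion because it is a morphism of vector bundles over `TA` which is
surjective on fibres. -/
theorem tangent [ID.Boundaryless] [IsManifold ID ∞ D] [IA.Boundaryless] [IsManifold IA ∞ A]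
    [IB.Boundaryless] [IsManifold IB ∞ B] [IM.Boundaryless] [IsManifold IM ∞ M]
    (hQ : Q.IsDoubleVectorBundle ID IA IB IM) :
    (Q.tangent ID IA IB IM).IsDoubleVectorBundle ID.tangent IA.tangent IB.tangent IM.tangent := by
  have hpB := hQ.proj_overB.tangent hQ.vb_overA hQ.vb_sideB hQ.vb_overB.contMDiff_proj
    hQ.vb_sideA.contMDiff_proj
  exact
  { vb_overA := hQ.vb_overA.tangent
    vb_overB := hQ.vb_overB.tangent
    vb_sideA := hQ.vb_sideA.tangent
    vb_sideB := hQ.vb_sideB.tangent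
    proj_overB := hpB
    proj_overA := hQ.proj_overA.tangent hQ.vb_overB hQ.vb_sideA hQ.vb_overA.contMDiff_proj
      hQ.vb_sideB.contMDiff_proj
    zero_overA := hQ.zero_overA.tangent hQ.vb_sideA hQ.vb_overB hQ.vb_overA.contMDiff_zero
      hQ.vb_sideB.contMDiff_zero
    zero_overB := hQ.zero_overB.tangent hQ.vb_sideB hQ.vb_overA hQ.vb_overB.contMDiff_zero
      hQ.vb_sideA.contMDiff_zero
    smul_overA := fun t => (hQ.smul_overA t).tangent hQ.vb_overB hQ.vb_overB
      (hQ.vb_overA.contMDiff_smul t) (hQ.vb_sideB.contMDiff_smul t)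
    smul_overB := fun t => (hQ.smul_overB t).tangent hQ.vb_overA hQ.vb_overA
      (hQ.vb_overB.contMDiff_smul t) (hQ.vb_sideA.contMDiff_smul t)
    interchange := hQ.tangent_interchange
    surjective := hQ.tangent_surjective
    submersion := fun d v w hv hw hvw => hpB.exists_tangentMap_eq hQ.vb_overA.tangent
      hQ.vb_sideB.tangent hQ.vb_overB.tangent.contMDiff_proj hQ.vb_sideA.tangent.contMDiff_proj
      hQ.tangent_surjective hv hw hvw }

/-- A vector tangent to `D` that projects to `T(0^A)(u)` and `T(0^B)(u)` is the velocity of a curve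
in the core: if `u` is the velocity of `m`, lift the compatible pair of curves `0^A ∘ m`,
`0^B ∘ m`. -/
theorem core_tangent [ID.Boundaryless] [IsManifold ID ∞ D] [IM.Boundaryless] [IsManifold IM ∞ M]
    (hQ : Q.IsDoubleVectorBundle ID IA IB IM) :
    (Q.tangent ID IA IB IM).core = tangentSet ID Q.core := by
  ext z
  constructor
  · rintro ⟨u, hzA, hzB⟩
    obtain ⟨m, hm, rfl⟩ := exists_isSmoothCurve_velocity u
    obtain ⟨γ, hγ, rfl, hγA, hγB⟩ := hQ.exists_isSmoothCurve_lift
      (hm.comp_contMDiff hQ.vb_sideA.contMDiff_zero) (hm.comp_contMDiff hQ.vb_sideB.contMDiff_zero)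
      (.of_forall fun t => by rw [hQ.vb_sideA.proj_zero, hQ.vb_sideB.proj_zero])
      (hzA.trans (hQ.vb_sideA.velocity_zero hm).symm)
      (hzB.trans (hQ.vb_sideB.velocity_zero hm).symm)
    refine ⟨γ, {t | ContMDiffAt 𝓘(ℝ, ℝ) ID ∞ γ t ∧ γ t ∈ Q.core}, ?_,
      fun t ht => ht.1.contMDiffWithinAt, fun t ht => ht.2, rfl⟩
    filter_upwards [hγ, hγA, hγB] with t h1 h2 h3 using ⟨h1, m t, h2, h3⟩
  · rintro ⟨γ, J, hJ, hγJ, hcore, rfl⟩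
    have hγ : IsSmoothCurve ID γ := by
      filter_upwards [eventually_mem_nhds_iff.2 hJ] with t ht using hγJ.contMDiffAt ht
    have hA := hγ.comp_contMDiff hQ.vb_overA.contMDiff_proj
    have hm := hA.comp_contMDiff hQ.vb_sideA.contMDiff_proj
    refine ⟨velocity IM fun t => Q.sideA.proj (Q.overA.proj (γ t)), ?_, ?_⟩
    · refine (hQ.vb_overA.velocity_proj hγ).symm.trans
        (Eq.trans (velocity_congr ?_) (hQ.vb_sideA.velocity_zero hm))
      filter_upwards [hJ] with t ht
      obtain ⟨m, h1, h2⟩ := hcore t ht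
      rw [h1, hQ.vb_sideA.proj_zero]
    · refine (hQ.vb_overB.velocity_proj hγ).symm.trans
        (Eq.trans (velocity_congr ?_) (hQ.vb_sideB.velocity_zero hm))
      filter_upwards [hJ] with t ht
      obtain ⟨m, h1, h2⟩ := hcore t ht
      rw [h1, h2, hQ.vb_sideA.proj_zero]

end IsDoubleVectorBundle

/-! ### Tangent grids -/

theorem IsLinearSection.tangent [IsManifold ID ∞ D] [IsManifold IA ∞ A]
    [IB.Boundaryless] [IsManifold IB ∞ B] [IM.Boundaryless] [IsManifold IM ∞ M]
    (hA : Q.overA.IsVectorBundle ID IA)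
    (hB : Q.overB.IsVectorBundle ID IB) (hsA : Q.sideA.IsVectorBundle IA IM)
    (hsB : Q.sideB.IsVectorBundle IB IM) {ξ : B → D} {X : M → A}
    (h : IsLinearSection ID IA IB IM Q ξ X) :
    IsLinearSection ID.tangent IA.tangent IB.tangent IM.tangent (Q.tangent ID IA IB IM)
      (tangentMap IB ID ξ) (tangentMap IM IA X) where
  smooth_base := h.smooth_base.contMDiff_tangentMap le_rfl
  section_base u := by
    obtain ⟨m, hm, rfl⟩ := exists_isSmoothCurve_velocity u
    rw [← velocity_comp hm (h.smooth_base.mdifferentiableAt (by simp))]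
    refine (hsA.velocity_proj (hm.comp_contMDiff h.smooth_base)).symm.trans ?_
    simp only [h.section_base]
  smooth := h.smooth.contMDiff_tangentMap le_rfl
  section_overB v := by
    obtain ⟨β, hβ, rfl⟩ := exists_isSmoothCurve_velocity v
    rw [← velocity_comp hβ (h.smooth.mdifferentiableAt (by simp))]
    refine (hB.velocity_proj (hβ.comp_contMDiff h.smooth)).symm.trans ?_
    simp only [h.section_overB]
  linear := h.linear.tangent hsB hA h.smooth h.smooth_base

theorem IsGrid.tangent [IsManifold ID ∞ D] [IA.Boundaryless] [IsManifold IA ∞ A]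
    [IB.Boundaryless] [IsManifold IB ∞ B] [IM.Boundaryless] [IsManifold IM ∞ M]
    (hQ : Q.IsDoubleVectorBundle ID IA IB IM) {ξ : B → D} {X : M → A}
    {η : A → D} {Y : M → B} (h : Q.IsGrid ID IA IB IM ξ X η Y) :
    (Q.tangent ID IA IB IM).IsGrid ID.tangent IA.tangent IB.tangent IM.tangent
      (tangentMap IB ID ξ) (tangentMap IM IA X) (tangentMap IA ID η) (tangentMap IM IB Y) where
  linear_ξ := h.linear_ξ.tangent hQ.vb_overA hQ.vb_overB hQ.vb_sideA hQ.vb_sideB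
  linear_η := h.linear_η.tangent hQ.vb_overB hQ.vb_overA hQ.vb_sideB hQ.vb_sideA

/-! ### Warps -/

section Warp

variable {ξ : B → D} {X : M → A} {η : A → D} {Y : M → B}

namespace IsGrid

variable (h : Q.IsGrid ID IA IB IM ξ X η Y)
include h

theorem overA_proj_ξ (m : M) : Q.overA.proj (ξ (Y m)) = X m := by
  rw [h.linear_ξ.linear.proj]
  exact congrArg X (h.linear_η.section_base m)

theorem overA_proj_η (m : M) : Q.overA.proj (η (X m)) = X m := h.linear_η.section_overB _

theorem overB_proj_ξ (m : M) : Q.overB.proj (ξ (Y m)) = Y m := h.linear_ξ.section_overB _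

theorem overB_proj_η (m : M) : Q.overB.proj (η (X m)) = Y m :=
  (h.linear_η.linear.proj _).trans (congrArg Y (h.linear_ξ.section_base m))

end IsGrid

theorem IsWarp.unique (hQ : Q.IsDoubleVectorBundle ID IA IB IM)
    (hgrid : Q.IsGrid ID IA IB IM ξ X η Y) {w w' : M → D} (hw : Q.IsWarp ID IM ξ X η Y w)
    (hw' : Q.IsWarp ID IM ξ X η Y w') : w = w' := by
  funext m
  have h0 : Q.overB.proj (Q.overA.zero (X m)) = Q.sideB.zero m := by
    rw [hQ.zero_overA.proj, hgrid.linear_ξ.section_base]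
  exact hQ.vb_overB.add_right_cancel (by rw [hw.overB_eq_zero, h0])
    (by rw [hw'.overB_eq_zero, h0]) ((hw.sub_overA m).symm.trans (hw'.sub_overA m))

/-- The warp is `(ξ -_A η) -_B 0^A`. With this definition the first formula for the warp is a
cancellation in a fibre of `D → B`, and the second one follows from the interchange law. -/
theorem IsGrid.exists_isWarp (hQ : Q.IsDoubleVectorBundle ID IA IB IM)
    (h : Q.IsGrid ID IA IB IM ξ X η Y) : ∃ w : M → D, Q.IsWarp ID IM ξ X η Y w := by
  have hA := hQ.vb_overA
  have hB := hQ.vb_overB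
  have hξη (m : M) : Q.overA.proj (ξ (Y m)) = Q.overA.proj (η (X m)) := by
    rw [h.overA_proj_ξ, h.overA_proj_η]
  have hξηB (m : M) : Q.overB.proj (ξ (Y m)) = Q.overB.proj (η (X m)) := by
    rw [h.overB_proj_ξ, h.overB_proj_η]
  let δ : M → D := fun m => Q.overA.sub (ξ (Y m)) (η (X m))
  have hδA (m : M) : Q.overA.proj (δ m) = X m := by
    rw [hA.proj_sub (hξη m), h.overA_proj_ξ]
  have hδB (m : M) : Q.overB.proj (δ m) = Q.sideB.zero m := by
    have hs := hξη m
    change Q.overB.proj (Q.overA.add _ _) = _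
    rw [hQ.proj_overB.add _ _ (by rw [hA.proj_smul, hs]), hQ.proj_overB.smul, hξηB m]
    refine (hQ.vb_sideB.sub_self _).trans ?_
    rw [h.overB_proj_η]
    exact congrArg _ (h.linear_η.section_base m)
  have h0B (m : M) : Q.overB.proj (Q.overA.zero (X m)) = Q.sideB.zero m := by
    rw [hQ.zero_overA.proj, h.linear_ξ.section_base]
  have h0A (m : M) : Q.overA.proj (Q.overB.zero (Y m)) = Q.sideA.zero m := by
    rw [hQ.zero_overB.proj]
    exact congrArg _ (h.linear_η.section_base m)
  have hδ0 (m : M) : Q.overB.proj (δ m) = Q.overB.proj (Q.overA.zero (X m)) := by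
    rw [hδB, h0B]
  let w : M → D := fun m => Q.overB.sub (δ m) (Q.overA.zero (X m))
  have hwB (m : M) : Q.overB.proj (w m) = Q.sideB.zero m := by rw [hB.proj_sub (hδ0 m), hδB]
  have hwA (m : M) : Q.overA.proj (w m) = Q.sideA.zero m := by
    change Q.overA.proj (Q.overB.add _ _) = _
    rw [hQ.proj_overA.add _ _ (by rw [hB.proj_smul, hδ0]), hQ.proj_overA.smul, hδA, hA.proj_zero]
    refine (hQ.vb_sideA.sub_self _).trans ?_
    rw [h.linear_ξ.section_base]
  have hwδ (m : M) : Q.overB.add (w m) (Q.overA.zero (X m)) = δ m := hB.sub_add_cancel (hδ0 m)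
  have hX : ContMDiff IM ID ∞ fun m => Q.overA.zero (X m) :=
    hA.contMDiff_zero.comp h.linear_ξ.smooth_base
  have hδsmooth : ContMDiff IM ID ∞ δ :=
    hA.contMDiff_sub (h.linear_ξ.smooth.comp h.linear_η.smooth_base)
      (h.linear_η.smooth.comp h.linear_ξ.smooth_base) hξη
  refine ⟨w, hB.contMDiff_sub hδsmooth hX hδ0, hwA, hwB, fun m => (hwδ m).symm, fun m => ?_⟩
  -- The interchange law turns `ξ = (w +_B 0^A) +_A η` into `ξ = (w +_A 0^B) +_B η`.
  have hw0 : Q.overA.proj (w m) = Q.overA.proj (Q.overB.zero (Y m)) := by rw [hwA, h0A]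
  have hη0 : Q.overA.proj (Q.overA.zero (X m)) = Q.overA.proj (η (X m)) := by
    rw [hA.proj_zero, h.overA_proj_η]
  have h0η : Q.overB.proj (Q.overB.zero (Y m)) = Q.overB.proj (η (X m)) := by
    rw [hB.proj_zero, h.overB_proj_η]
  have key : ξ (Y m) = Q.overB.add (Q.overA.add (w m) (Q.overB.zero (Y m))) (η (X m)) := by
    have hi := hQ.interchange (w m) (Q.overB.zero (Y m)) (Q.overA.zero (X m)) (η (X m)) hw0 hη0
      (by rw [hwB, h0B]) h0η
    rw [hA.zero_add (h.overA_proj_η m), hwδ, hB.zero_add (h.overB_proj_η m),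
      hA.sub_add_cancel (hξη m)] at hi
    exact hi.symm
  have hp : Q.overB.proj (Q.overA.add (w m) (Q.overB.zero (Y m))) = Q.overB.proj (η (X m)) := by
    rw [hQ.proj_overB.add _ _ hw0, hwB, hB.proj_zero, h.overB_proj_η]
    exact hQ.vb_sideB.zero_add (h.linear_η.section_base m)
  conv_lhs => rw [key]
  exact hB.add_sub_cancel_right hp

theorem IsWarp.tangent [ID.Boundaryless] [IsManifold ID ∞ D] [IA.Boundaryless] [IsManifold IA ∞ A]
    [IB.Boundaryless] [IsManifold IB ∞ B] [IM.Boundaryless] [IsManifold IM ∞ M]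
    (hQ : Q.IsDoubleVectorBundle ID IA IB IM) (hgrid : Q.IsGrid ID IA IB IM ξ X η Y) {w : M → D}
    (hw : Q.IsWarp ID IM ξ X η Y w) :
    (Q.tangent ID IA IB IM).IsWarp ID.tangent IM.tangent (tangentMap IB ID ξ) (tangentMap IM IA X)
      (tangentMap IA ID η) (tangentMap IM IB Y) (tangentMap IM ID w) := by
  have hA := hQ.vb_overA
  have hB := hQ.vb_overB
  have hξs := hgrid.linear_ξ.smooth
  have hηs := hgrid.linear_η.smooth
  have hXs := hgrid.linear_ξ.smooth_base
  have hYs := hgrid.linear_η.smooth_base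
  refine ⟨hw.smooth.contMDiff_tangentMap le_rfl, fun u => ?_, fun u => ?_, fun u => ?_,
    fun u => ?_⟩
  all_goals
    obtain ⟨m, hm, rfl⟩ := exists_isSmoothCurve_velocity u
    have hwm := hm.comp_contMDiff hw.smooth
    have hXm := hm.comp_contMDiff hXs
    have hYm := hm.comp_contMDiff hYs
    have hξm := hYm.comp_contMDiff hξs
    have hηm := hXm.comp_contMDiff hηs
  · rw [← velocity_comp hm (hw.smooth.mdifferentiableAt (by simp))]
    refine (hA.velocity_proj hwm).symm.trans (Eq.trans ?_ (hQ.vb_sideA.velocity_zero hm))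
    simp only [hw.overA_eq_zero]
  · rw [← velocity_comp hm (hw.smooth.mdifferentiableAt (by simp))]
    refine (hB.velocity_proj hwm).symm.trans (Eq.trans ?_ (hQ.vb_sideB.velocity_zero hm))
    simp only [hw.overB_eq_zero]
  · rw [← velocity_comp hm (hw.smooth.mdifferentiableAt (by simp)),
      ← velocity_comp hm (hXs.mdifferentiableAt (by simp)),
      ← velocity_comp hm (hYs.mdifferentiableAt (by simp)),
      ← velocity_comp hYm (hξs.mdifferentiableAt (by simp)),
      ← velocity_comp hXm (hηs.mdifferentiableAt (by simp))]
    refine (hA.velocity_sub hξm hηm (.of_forall fun t => ?_)).symm.trans (Eq.trans ?_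
      ((hB.velocity_add hwm (hXm.comp_contMDiff hA.contMDiff_zero) (.of_forall fun t => ?_)).trans
        (congrArg _ (hA.velocity_zero hXm))))
    · rw [hgrid.overA_proj_ξ, hgrid.overA_proj_η]
    · simp only [hw.sub_overA]
    · rw [hw.overB_eq_zero, hQ.zero_overA.proj, hgrid.linear_ξ.section_base]
  · rw [← velocity_comp hm (hw.smooth.mdifferentiableAt (by simp)),
      ← velocity_comp hm (hXs.mdifferentiableAt (by simp)),
      ← velocity_comp hm (hYs.mdifferentiableAt (by simp)),
      ← velocity_comp hYm (hξs.mdifferentiableAt (by simp)),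
      ← velocity_comp hXm (hηs.mdifferentiableAt (by simp))]
    refine (hB.velocity_sub hξm hηm (.of_forall fun t => ?_)).symm.trans (Eq.trans ?_
      ((hA.velocity_add hwm (hYm.comp_contMDiff hB.contMDiff_zero) (.of_forall fun t => ?_)).trans
        (congrArg _ (hB.velocity_zero hYm))))
    · rw [hgrid.overB_proj_ξ, hgrid.overB_proj_η]
    · simp only [hw.sub_overB]
    · rw [hw.overA_eq_zero, hQ.zero_overB.proj]
      exact (congrArg _ (hgrid.linear_η.section_base (m t))).symm

end Warp

end DVBData

theorem proposition5p4
    {ED HD D EA HA A EB HB B EM HM M : Type*}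
    [NormedAddCommGroup ED] [NormedSpace ℝ ED] [FiniteDimensional ℝ ED] [TopologicalSpace HD]
    [NormedAddCommGroup EA] [NormedSpace ℝ EA] [FiniteDimensional ℝ EA] [TopologicalSpace HA]
    [NormedAddCommGroup EB] [NormedSpace ℝ EB] [FiniteDimensional ℝ EB] [TopologicalSpace HB]
    [NormedAddCommGroup EM] [NormedSpace ℝ EM] [FiniteDimensional ℝ EM] [TopologicalSpace HM]
    [TopologicalSpace D] [ChartedSpace HD D] [TopologicalSpace A] [ChartedSpace HA A]
    [TopologicalSpace B] [ChartedSpace HB B] [TopologicalSpace M] [ChartedSpace HM M]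
    (ID : ModelWithCorners ℝ ED HD) [ID.Boundaryless] [IsManifold ID ∞ D]
    (IA : ModelWithCorners ℝ EA HA) [IA.Boundaryless] [IsManifold IA ∞ A]
    (IB : ModelWithCorners ℝ EB HB) [IB.Boundaryless] [IsManifold IB ∞ B]
    (IM : ModelWithCorners ℝ EM HM) [IM.Boundaryless] [IsManifold IM ∞ M]
    (Q : DVBData D A B M) (hQ : Q.IsDoubleVectorBundle ID IA IB IM)
    (ξ : B → D) (X : M → A) (η : A → D) (Y : M → B)
    (hgrid : Q.IsGrid ID IA IB IM ξ X η Y) :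
    -- the tangent square is a double vector bundle, and its core is `TC`
    (Q.tangent ID IA IB IM).IsDoubleVectorBundle ID.tangent IA.tangent IB.tangent IM.tangent ∧
    (Q.tangent ID IA IB IM).core = tangentSet ID Q.core ∧
    -- the tangent maps form a grid on it
    (Q.tangent ID IA IB IM).IsGrid ID.tangent IA.tangent IB.tangent IM.tangent
      (tangentMap IB ID ξ) (tangentMap IM IA X) (tangentMap IA ID η) (tangentMap IM IB Y) ∧
    -- the original grid has exactly one warp `w`, and the tangent grid has exactly one warp, `T(w)`
    (∃! w : M → D, Q.IsWarp ID IM ξ X η Y w) ∧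
    ∀ w : M → D, Q.IsWarp ID IM ξ X η Y w →
      ∀ W : TangentBundle IM M → TangentBundle ID D,
        (Q.tangent ID IA IB IM).IsWarp ID.tangent IM.tangent
          (tangentMap IB ID ξ) (tangentMap IM IA X) (tangentMap IA ID η) (tangentMap IM IB Y) W ↔
        W = tangentMap IM ID w := by
  obtain ⟨w, hw⟩ := hgrid.exists_isWarp hQ
  have hQT := hQ.tangent
  have hgridT := hgrid.tangent hQ
  refine ⟨hQT, hQ.core_tangent, hgridT, ⟨w, hw, fun w' hw' => hw'.unique hQ hgrid hw⟩,
    fun w' hw' W => ⟨fun hW => hW.unique hQT hgridT (hw'.tangent hQ hgrid), ?_⟩⟩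
  rintro rfl
  exact hw'.tangent hQ hgrid
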